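/- Let $(M,d)$ be a complete metric space, $(\Omega,\mathcal A,\mathbf P)$ a probability space, $T:\Omega\to\Omega$ a measurable $\mathbf P$-preserving map, and $1\le p<\infty$. Let $\mathcal P^p(M)$ be the set of Borel probability measures $\mu$ on $M$ with $\mu(\operatorname{supp}\mu)=1$ and $\int_M d(x,y)^p\,d\mu(y)<\infty$ for some $x\in M$, with the $p$-Wasserstein distance $$d_p^W(\mu,\nu)=\Bigl[\inf_\pi\int_{M\times M} d(x,y)^p\,d\pi(x,y)\Bigr]^{1/p},$$ the infimum being over all couplings $\pi$ of $\mu$ and $\nu$. Let $\mathcal C_p(M)$ be the set of $p$-contractive barycentric maps, that is, maps $\beta:\mathcal P^p(M)\to M$ with $\beta(\delta_x)=x$ for all $x\in M$ and $d(\beta(\mu),\beta(\nu))\le d_p^W(\mu,\nu)$ for all $\mu,\nu\in\mathcal P^p(M)$. It carries the metric $$d_p(\beta_1,\beta_2)=\sup\frac{d(\beta_1(\mathbf x),\beta_2(\mathbf x))}{\Delta(\mathbf x)},$$ the supremum being over all $n\ge 1$ and all $\mathbf x=(x_1,\dots,x_n)\in M^n$ with diameter $\Delta(\mathbf x)\ne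 0$, where $\beta(\mathbf x):=\beta\bigl(\frac1n\sum_{j=1}^n\delta_{x_j}\bigr)$ (the supremum of the empty set being $0$). Let $L^p(\Omega;M)$ be the set of (a.e. classes of) strongly measurable $\varphi:\Omega\to M$ with $\int_\Omega d(x,\varphi)^p\,d\mathbf P<\infty$ for some $x\in M$, with the metric $\mathbf d_p(\varphi,\psi)=\bigl[\int_\Omega d(\varphi,\psi)^p\,d\mathbf P\bigr]^{1/p}$. For $\beta\in\mathcal C_p(M)$ and $\varphi\in L^p(\Omega;M)$ put $E^\beta(\varphi):=\beta(\varphi_*\mathbf P)$, and let $\Gamma_\beta(\varphi)$ be the a.e. limit $$\Gamma_\beta(\varphi)(\omega)=\lim_{n\to\infty}\beta\Bigl(\frac1n\sum_{k=0}^{n-1}\delta_{\varphi(T^k\omega)}\Bigr).$$ Then the following hold. (0) For all $\beta\in\mathcal C_p(M)$ and $\varphi\in L^p(\Omega;M)$ this limit exists for a.e. $\omega$, $\Gamma_\beta(\varphi)$ belongs to $L^p(\Omega;M)$, and $\Gamma_\beta(\varphi)\circ T=\Gamma_\beta(\varphi)$ a.e. (1) The map $\Gamma:(\beta,\varphi)\mapsto\Gamma_\beta(\varphi)$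 is continuous from $\mathcal C_p(M)\times L^p(\Omega;M)$ to $L^p(\Omega;M)$ with respect to the product metric of $d_p$ and $\mathbf d_p$; that is, if $\beta_k\to\beta$ in $d_p$ and $\varphi_k\to\varphi$ in $\mathbf d_p$, then $\Gamma_{\beta_k}(\varphi_k)\to\Gamma_\beta(\varphi)$ in $\mathbf d_p$. (2) If $T$ is ergodic, $\beta_k\to\beta$ in $d_p$ and $\varphi_k\to\varphi$ in $\mathbf d_p$, then $E^{\beta_k}(\varphi_k)\to E^\beta(\varphi)$ in $M$. (3) If $(\Omega,\mathcal A)$ is a standard Borel space and $\beta_k\to\beta$ in $d_p$, then for every $\varphi\in L^p(\Omega;M)$, $\Gamma_{\beta_k}(\varphi)(\omega)\to\Gamma_\beta(\varphi)(\omega)$ for a.e. $\omega\in\Omega$. -/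

import Mathlib

open MeasureTheory Filter Topology
open scoped ENNReal

namespace BaryErgodic

noncomputable section

/-! ### Probability measures with full support and finite `p`-th moment -/

/-- `μ` is a Borel probability measure on `M` of full support (its support has measure one) and
with finite `p`-th moment about some point of `M`. -/
structure IsWassersteinMeasure {M : Type*} [MetricSpace M] [MeasurableSpace M]
    (p : ℝ) (μ : Measure M) : Prop where
  isProbabilityMeasure : IsProbabilityMeasure μ
  support_full : μ μ.supportᶜ = 0
  moment_finite : ∃ x : M, ∫⁻ y, edist x y ^ p ∂μ < ∞

/-- The space `𝒫^p(M)`. -/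
def PMeas (M : Type*) [MetricSpace M] [MeasurableSpace M] (p : ℝ) : Type _ :=
  {μ : Measure M // IsWassersteinMeasure p μ}

/-- `π` is a coupling of `μ` and `ν`: its two marginals are `μ` and `ν`. The `σ`-algebra of `M × M`
is the product one. Measures of full support live on a closed separable set `S`, so their couplings
live on `S × S`, where the product `σ`-algebra is the Borel one; hence it makes no difference
whether couplings are taken on the product or on the Borel `σ`-algebra, and couplings have full
support automatically. -/
def IsCoupling {M : Type*} [MeasurableSpace M] (π : Measure (M × M)) (μ ν : Measure M) : Prop :=
  π.map Prod.fst = μ ∧ π.map Prod.snd = ν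

/-- The `p`-Wasserstein distance
`[inf { ∫ d(x,y)^p dπ(x,y) : π a coupling of μ and ν }]^{1/p}`. -/
def wasserstein {M : Type*} [MetricSpace M] [MeasurableSpace M] (p : ℝ) (μ ν : Measure M) : ℝ≥0∞ :=
  (⨅ π : {π : Measure (M × M) // IsCoupling π μ ν},
    ∫⁻ z, edist z.1 z.2 ^ p ∂(π : Measure (M × M))) ^ (1 / p)

/-! ### The space `L^p(Ω; M)` -/

/-- `L^p(Ω, P; M)`: the `P`-a.e. classes of strongly measurable maps `f : Ω → M` such that
`∫ d(x, f)^p dP < ∞` for some `x ∈ M`. -/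
def LpMap {Ω : Type*} [MeasurableSpace Ω] (M : Type*) [MetricSpace M] (p : ℝ) (P : Measure Ω) :
    Type _ :=
  {f : Ω →ₘ[P] M // ∃ x : M, ∫⁻ ω, edist x (f ω) ^ p ∂P < ∞}

section Facts

variable {Ω M : Type*} [MeasurableSpace Ω] [MetricSpace M]

/-- A class in `L^p(Ω; M)` is used as a function through its chosen representative. -/
instance (p : ℝ) (P : Measure Ω) : CoeFun (LpMap M p P) (fun _ => Ω → M) := ⟨fun f => f.1⟩

theorem LpMap.aestronglyMeasurable {p : ℝ} {P : Measure Ω} (f : LpMap M p P) :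
    AEStronglyMeasurable f P := f.1.aestronglyMeasurable

theorem lintegral_triangle {p : ℝ} (hp : 1 ≤ p) {P : Measure Ω} {f g h : Ω → M}
    (hf : AEStronglyMeasurable f P) (hg : AEStronglyMeasurable g P)
    (hh : AEStronglyMeasurable h P) :
    (∫⁻ ω, edist (f ω) (h ω) ^ p ∂P) ^ (1 / p) ≤
      (∫⁻ ω, edist (f ω) (g ω) ^ p ∂P) ^ (1 / p) + (∫⁻ ω, edist (g ω) (h ω) ^ p ∂P) ^ (1 / p) := by
  have hp0 : 0 ≤ p := zero_le_one.trans hp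
  refine le_trans ?_ (ENNReal.lintegral_Lp_add_le (hf.edist hg) (hg.edist hh) hp)
  refine ENNReal.rpow_le_rpow (lintegral_mono fun ω => ?_) (by positivity)
  exact ENNReal.rpow_le_rpow (edist_triangle _ _ _) hp0

/-- The distance `𝐝_p(f, g) = [∫ d(f, g)^p dP]^{1/p}`, as an extended metric. -/
instance (p : ℝ) [hp : Fact (1 ≤ p)] (P : Measure Ω) : EMetricSpace (LpMap M p P) where
  edist f g := (∫⁻ ω, edist (f ω) (g ω) ^ p ∂P) ^ (1 / p)
  edist_self f := by
    have : 0 < p := zero_lt_one.trans_le hp.out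
    simp [this]
  edist_comm f g := by simp only [edist_comm]
  edist_triangle f g h := lintegral_triangle hp.out f.aestronglyMeasurable
    g.aestronglyMeasurable h.aestronglyMeasurable
  eq_of_edist_eq_zero {f g} h := by
    have hp0 : 0 < p := zero_lt_one.trans_le hp.out
    have h1 : ∫⁻ ω, edist (f ω) (g ω) ^ p ∂P = 0 := by
      rcases ENNReal.rpow_eq_zero_iff.1 h with h | h
      · exact h.1
      · exact absurd h.2 (not_lt.2 (by positivity))
    rw [lintegral_eq_zero_iff'
      ((f.aestronglyMeasurable.edist g.aestronglyMeasurable).pow_const p)] at h1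
    refine Subtype.ext (AEEqFun.ext ?_)
    filter_upwards [h1] with ω hω
    have : edist (f ω) (g ω) = 0 := by simpa [hp0, hp0.not_gt] using hω
    exact edist_eq_zero.1 this

/-- The metric `𝐝_p` on `L^p(Ω; M)`. -/
instance (p : ℝ) [hp : Fact (1 ≤ p)] (P : Measure Ω) [IsProbabilityMeasure P] :
    MetricSpace (LpMap M p P) :=
  EMetricSpace.toMetricSpace fun f g => by
    have hp0 : 0 < p := zero_lt_one.trans_le hp.out
    obtain ⟨x, hx⟩ := f.2
    obtain ⟨y, hy⟩ := g.2
    have hfx : (∫⁻ ω, edist (f ω) x ^ p ∂P) ^ (1 / p) < ∞ := by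
      simp only [edist_comm _ x]
      exact ENNReal.rpow_lt_top_of_nonneg (by positivity) hx.ne
    have hyg : (∫⁻ ω, edist y (g ω) ^ p ∂P) ^ (1 / p) < ∞ :=
      ENNReal.rpow_lt_top_of_nonneg (by positivity) hy.ne
    have hxy : (∫⁻ _ : Ω, edist x y ^ p ∂P) ^ (1 / p) < ∞ := by
      refine ENNReal.rpow_lt_top_of_nonneg (by positivity) ?_
      simpa using ENNReal.rpow_ne_top_of_nonneg hp0.le (edist_ne_top x y)
    have h1 := lintegral_triangle hp.out f.aestronglyMeasurable
      (aestronglyMeasurable_const (b := x)) g.aestronglyMeasurable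
    have h2 := lintegral_triangle hp.out (aestronglyMeasurable_const (μ := P) (b := x))
      (aestronglyMeasurable_const (b := y)) g.aestronglyMeasurable
    exact (h1.trans_lt (ENNReal.add_lt_top.2
      ⟨hfx, h2.trans_lt (ENNReal.add_lt_top.2 ⟨hxy, hyg⟩)⟩)).ne

variable [MeasurableSpace M]

/-- A measure that is carried by a separable set is carried by its support. -/
theorem measure_compl_support_of_isSeparable (μ : Measure M) {t : Set M}
    (ht : TopologicalSpace.IsSeparable t) (h : μ tᶜ = 0) : μ μ.supportᶜ = 0 := by
  have := ht.separableSpace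
  have hsec : SecondCountableTopology t := UniformSpace.secondCountable_of_separable t
  have hL : IsLindelof (t ∩ μ.supportᶜ) := by
    have h1 : IsLindelof ((↑) ⁻¹' μ.supportᶜ : Set t) := HereditarilyLindelofSpace.isLindelof _
    have h2 := h1.image (f := ((↑) : t → M)) continuous_subtype_val
    rwa [Subtype.image_preimage_coe] at h2
  have h0 : (t ∩ μ.supportᶜ)ᶜ ∈ ae μ := by
    refine hL.compl_mem_sets_of_nhdsWithin ?_
    rintro x ⟨-, hx⟩
    obtain ⟨U, hU, hU0⟩ := Measure.notMem_support_iff_exists.1 hx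
    exact ⟨U, mem_nhdsWithin_of_mem_nhds hU, compl_mem_ae_iff.2 hU0⟩
  refine measure_mono_null (t := tᶜ ∪ (t ∩ μ.supportᶜ)) ?_
    (measure_union_null h (compl_mem_ae_iff.1 h0))
  intro x hx
  by_cases hxt : x ∈ t
  · exact Or.inr ⟨hxt, hx⟩
  · exact Or.inl hxt

variable [BorelSpace M]

theorem LpMap.isWassersteinMeasure_map {p : ℝ} {P : Measure Ω} [IsProbabilityMeasure P]
    (f : LpMap M p P) : IsWassersteinMeasure p (P.map f) where
  isProbabilityMeasure := Measure.isProbabilityMeasure_map f.aestronglyMeasurable.aemeasurable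
  support_full := by
    obtain ⟨t, ht, hft⟩ := f.aestronglyMeasurable.isSeparable_ae_range
    refine measure_compl_support_of_isSeparable _ ht.closure ?_
    rw [Measure.map_apply_of_aemeasurable f.aestronglyMeasurable.aemeasurable
      isClosed_closure.measurableSet.compl, ← compl_compl (f ⁻¹' (closure t)ᶜ), ← mem_ae_iff]
    filter_upwards [hft] with ω hω
    simpa using subset_closure hω
  moment_finite := by
    obtain ⟨x, hx⟩ := f.2
    refine ⟨x, ?_⟩
    rwa [lintegral_map' (by fun_prop) f.aestronglyMeasurable.aemeasurable]

theorem isWassersteinMeasure_dirac (p : ℝ) [hp : Fact (1 ≤ p)] (x : M) :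
    IsWassersteinMeasure p (Measure.dirac x) where
  isProbabilityMeasure := inferInstance
  support_full := by
    refine measure_compl_support_of_isSeparable _ (Set.finite_singleton x).isSeparable ?_
    simp [Measure.dirac_apply' x (measurableSet_singleton x).compl]
  moment_finite := ⟨x, by
    have : 0 < p := zero_lt_one.trans_le hp.out
    simp [lintegral_dirac, this]⟩

/-- The uniform measure `n⁻¹ ∑_j δ_{x_j}` of an `n`-tuple. -/
def tupleMeasure {n : ℕ} (x : Fin n → M) : Measure M :=
  (n : ℝ≥0∞)⁻¹ • ∑ j, Measure.dirac (x j)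

theorem isWassersteinMeasure_tupleMeasure (p : ℝ) [hp : Fact (1 ≤ p)] {n : ℕ}
    (x : Fin (n + 1) → M) : IsWassersteinMeasure p (tupleMeasure x) where
  isProbabilityMeasure := ⟨by
    simp only [tupleMeasure, Measure.smul_apply, Measure.coe_finsetSum, Finset.sum_apply,
      measure_univ, Finset.sum_const, Finset.card_univ, Fintype.card_fin, nsmul_eq_mul, mul_one,
      smul_eq_mul]
    exact ENNReal.inv_mul_cancel (by simp) (by finiteness)⟩
  support_full := by
    refine measure_compl_support_of_isSeparable _ (Set.finite_range x).isSeparable ?_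
    simp [tupleMeasure, Measure.dirac_apply' _ (Set.finite_range x).measurableSet.compl]
  moment_finite := ⟨x 0, by
    have hp0 : 0 < p := zero_lt_one.trans_le hp.out
    simp only [tupleMeasure, lintegral_smul_measure, lintegral_finsetSum_measure, lintegral_dirac,
      smul_eq_mul]
    refine ENNReal.mul_lt_top (by simp) (ENNReal.sum_lt_top.2 fun j _ => ?_)
    exact ENNReal.rpow_lt_top_of_nonneg hp0.le (edist_ne_top _ _)⟩

end Facts

section Barycenter

variable {Ω M : Type*} [MeasurableSpace Ω] [MetricSpace M] [MeasurableSpace M] [BorelSpace M]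

/-- The point mass `δ_x` as an element of `𝒫^p(M)`. -/
def diracP (p : ℝ) [Fact (1 ≤ p)] (x : M) : PMeas M p :=
  ⟨Measure.dirac x, isWassersteinMeasure_dirac p x⟩

/-- `(n+1)⁻¹ ∑_j δ_{x_j}` as an element of `𝒫^p(M)`. -/
def tupleP (p : ℝ) [Fact (1 ≤ p)] {n : ℕ} (x : Fin (n + 1) → M) : PMeas M p :=
  ⟨tupleMeasure x, isWassersteinMeasure_tupleMeasure p x⟩

/-- The law `f_* P` of `f ∈ L^p(Ω; M)` as an element of `𝒫^p(M)`. -/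
def LpMap.law {p : ℝ} {P : Measure Ω} [IsProbabilityMeasure P] (f : LpMap M p P) : PMeas M p :=
  ⟨P.map f, f.isWassersteinMeasure_map⟩

variable (M) in
/-- The set `𝒞_p(M)` of `p`-contractive barycentric maps `β : 𝒫^p(M) → M`. -/
structure BaryMap (p : ℝ) [Fact (1 ≤ p)] where
  toFun : PMeas M p → M
  map_dirac : ∀ x, toFun (diracP p x) = x
  contractive : ∀ μ ν : PMeas M p, edist (toFun μ) (toFun ν) ≤ wasserstein p μ.1 ν.1

instance (p : ℝ) [Fact (1 ≤ p)] : CoeFun (BaryMap M p) (fun _ => PMeas M p → M) :=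
  ⟨BaryMap.toFun⟩

/-- The distance `d_p(β₁, β₂) = sup d(β₁(x), β₂(x)) / Δ(x)`, the supremum being over all tuples
`x = (x_1, …, x_n)` of points of `M`, of any length `n ≥ 1`, with diameter `Δ(x) ≠ 0`, where
`β(x)` stands for `β(n⁻¹ ∑_j δ_{x_j})`. That distinct maps have positive distance is not needed
for the topology, so only the pseudometric axioms are recorded. -/
instance (p : ℝ) [Fact (1 ≤ p)] : PseudoEMetricSpace (BaryMap M p) where
  edist β₁ β₂ := ⨆ (n : ℕ) (x : Fin (n + 1) → M) (_ : Metric.ediam (Set.range x) ≠ 0),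
    edist (β₁ (tupleP p x)) (β₂ (tupleP p x)) / Metric.ediam (Set.range x)
  edist_self β := by simp
  edist_comm β₁ β₂ := by simp only [edist_comm]
  edist_triangle β₁ β₂ β₃ := by
    refine iSup_le fun n => iSup_le fun x => iSup_le fun hx => ?_
    refine (ENNReal.div_le_div_right (edist_triangle _ (β₂ (tupleP p x)) _) _).trans ?_
    rw [ENNReal.add_div]
    refine add_le_add ?_ ?_
    · exact le_iSup_of_le n (le_iSup_of_le x (le_iSup_of_le hx le_rfl))
    · exact le_iSup_of_le n (le_iSup_of_le x (le_iSup_of_le hx le_rfl))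

/-- The `β`-expectation `E^β(f) = β(f_* P)`. -/
def expect {p : ℝ} [Fact (1 ≤ p)] {P : Measure Ω} [IsProbabilityMeasure P] (β : BaryMap M p)
    (f : LpMap M p P) : M :=
  β f.law

/-- `empirical T f n ω` is the empirical measure of length `n + 1`,
`(n+1)⁻¹ ∑_{k=0}^{n} δ_{f(T^k ω)}`. -/
def empirical {p : ℝ} [Fact (1 ≤ p)] {P : Measure Ω} (T : Ω → Ω) (f : LpMap M p P) (n : ℕ)
    (ω : Ω) : PMeas M p :=
  tupleP p fun k : Fin (n + 1) => f (T^[k] ω)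

/-- `g` is the a.e. limit of the barycenters of the empirical measures of `f`. -/
def IsErgodicLimit {p : ℝ} [Fact (1 ≤ p)] {P : Measure Ω} (T : Ω → Ω) (β : BaryMap M p)
    (f g : LpMap M p P) : Prop :=
  ∀ᵐ ω ∂P, Tendsto (fun n => β (empirical T f n ω)) atTop (𝓝 (g ω))

open Classical in
/-- The map `Γ_β : L^p(Ω; M) → L^p(Ω; M)`: the a.e. limit of the barycenters of the empirical
measures (with an irrelevant value where there is no such limit in `L^p(Ω; M)`). -/
def Gam {p : ℝ} [Fact (1 ≤ p)] {P : Measure Ω} (T : Ω → Ω) (β : BaryMap M p)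
    (f : LpMap M p P) : LpMap M p P :=
  if h : ∃ g : LpMap M p P, IsErgodicLimit T β f g then h.choose else f

end Barycenter

end

end BaryErgodic

/-!
By the maximal ergodic inequality the upper limit of the ergodic averages of `f ≥ 0` has integral at
most `∫ f`. Applied to `d(φ, ψ)^p`, it makes the orbit distance, which bounds the distance of the
limiting barycenters of `φ` and `ψ`, small for almost every `ω` along a sequence of finitely valued
`ψ` approximating `φ`, so that only finitely valued maps have to be treated. The empirical measures
of such a map have atoms in a fixed finite set, and two probability measures on a finite set are
close as soon as their masses at each point are: a coupling need not move the common mass. The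
masses converge a.e., because the upper averages of the indicators of `A` and of `Aᶜ` have sum at
least `1` pointwise and at most `1` in the mean.

For the dependence on `β`, rounding weights to multiples of `1 / n` extends the bound
`d(β(x), β'(x)) ≤ d_p(β, β') Δ(x)` from tuples to all measures on a finite set. Hence `Γ` and `E`
are continuous in `β` at a finitely valued `φ`. They are `1`-Lipschitz in `φ`, and finitely valued
maps are dense, so they are jointly continuous.
-/

namespace BaryErgodic

open scoped NNReal

noncomputable section

section ErgodicAverages

variable {Ω : Type*}

theorem birkhoffAverage_eq_div (T : Ω → Ω) (f : Ω → ℝ≥0∞) (n : ℕ) (ω : Ω) :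
    birkhoffAverage ℝ≥0 T f n ω = birkhoffSum T f n ω / n := by
  rcases n.eq_zero_or_pos with rfl | hn
  · simp
  · rw [birkhoffAverage, ENNReal.smul_def, ENNReal.coe_inv (by positivity), smul_eq_mul,
      ENNReal.div_eq_inv_mul, ENNReal.coe_natCast]

theorem birkhoffSum_mono_right (T : Ω → Ω) (f : Ω → ℝ≥0∞) {m n : ℕ} (h : m ≤ n) (ω : Ω) :
    birkhoffSum T f m ω ≤ birkhoffSum T f n ω :=
  Finset.sum_le_sum_of_subset (Finset.range_subset_range.2 h)

/-- The upper limit of the ergodic averages `n⁻¹ ∑_{k<n} f(T^k ω)`. -/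
def upperAverage (T : Ω → Ω) (f : Ω → ℝ≥0∞) (ω : Ω) : ℝ≥0∞ :=
  limsup (fun n => birkhoffAverage ℝ≥0 T f n ω) atTop

theorem birkhoffAverage_comp_le (T : Ω → Ω) (f : Ω → ℝ≥0∞) (n : ℕ) (ω : Ω) :
    birkhoffAverage ℝ≥0 T f n (T ω) ≤
      (1 + (n : ℝ≥0∞)⁻¹) * birkhoffAverage ℝ≥0 T f (n + 1) ω := by
  rcases n.eq_zero_or_pos with rfl | hn
  · simp
  have hn0 : (n : ℝ≥0∞) ≠ 0 := by simpa using hn.ne'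
  have hratio : 1 + (n : ℝ≥0∞)⁻¹ = (n + 1 : ℕ) / n := by
    rw [Nat.cast_add_one, ENNReal.add_div, ENNReal.div_self hn0 (by finiteness), one_div]
  calc birkhoffAverage ℝ≥0 T f n (T ω) = birkhoffSum T f n (T ω) / n :=
        birkhoffAverage_eq_div T f n (T ω)
    _ ≤ birkhoffSum T f (n + 1) ω / n := by
        rw [birkhoffSum_succ']
        gcongr
        exact le_add_self
    _ = (1 + (n : ℝ≥0∞)⁻¹) * birkhoffAverage ℝ≥0 T f (n + 1) ω := by
        rw [birkhoffAverage_eq_div, hratio, mul_comm, ← mul_div_assoc,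
          ENNReal.div_mul_cancel (by simp) (by finiteness)]

theorem upperAverage_comp_le (T : Ω → Ω) (f : Ω → ℝ≥0∞) (ω : Ω) :
    upperAverage T f (T ω) ≤ upperAverage T f ω := by
  have hone : limsup (fun n : ℕ => 1 + (n : ℝ≥0∞)⁻¹) atTop = 1 := by
    simpa using (ENNReal.tendsto_inv_nat_nhds_zero.const_add 1).limsup_eq
  calc upperAverage T f (T ω)
      ≤ limsup ((fun n : ℕ => 1 + (n : ℝ≥0∞)⁻¹) *
          fun n => birkhoffAverage ℝ≥0 T f (n + 1) ω) atTop :=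
        limsup_le_limsup (.of_forall fun n => birkhoffAverage_comp_le T f n ω)
    _ ≤ limsup (fun n : ℕ => 1 + (n : ℝ≥0∞)⁻¹) atTop *
          limsup (fun n => birkhoffAverage ℝ≥0 T f (n + 1) ω) atTop :=
        ENNReal.limsup_mul_le' (by simp [hone]) (by simp [hone])
    _ = upperAverage T f ω := by
        rw [hone, one_mul, limsup_nat_add (fun n => birkhoffAverage ℝ≥0 T f n ω) 1, upperAverage]

theorem exists_birkhoffSum_lt_of_lt_upperAverage {T : Ω → Ω} {f g : Ω → ℝ≥0∞} {ω : Ω}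
    (hg : ∀ ω, g (T ω) ≤ g ω) (h : g ω < upperAverage T f ω) :
    ∃ n, birkhoffSum T g n ω < birkhoffSum T f n ω := by
  obtain ⟨n, hn⟩ := (frequently_lt_of_lt_limsup (by isBoundedDefault) h).exists
  have hiter : ∀ k, g (T^[k] ω) ≤ g ω := fun k => by
    induction k with
    | zero => rfl
    | succ k ih => rw [Function.iterate_succ_apply']; exact (hg _).trans ih
  refine ⟨n, ?_⟩
  calc birkhoffSum T g n ω ≤ g ω * n := by
        simpa [birkhoffSum, mul_comm] using
          Finset.sum_le_card_nsmul (Finset.range n) _ _ fun k _ => hiter k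
    _ < birkhoffSum T f n ω :=
        ENNReal.mul_lt_of_lt_div (birkhoffAverage_eq_div T f n ω ▸ hn)

/-- The maximal function `max_{n ≤ N} (∑_{k<n} f(T^k ω) - ∑_{k<n} g(T^k ω))` of the maximal ergodic
theorem. Subtraction being truncated, it is nonnegative. -/
def maximalExcess (T : Ω → Ω) (f g : Ω → ℝ≥0∞) (N : ℕ) (ω : Ω) : ℝ≥0∞ :=
  (Finset.range (N + 1)).sup fun n => birkhoffSum T f n ω - birkhoffSum T g n ω

theorem maximalExcess_mono (T : Ω → Ω) (f g : Ω → ℝ≥0∞) (ω : Ω) :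
    Monotone fun N => maximalExcess T f g N ω :=
  fun _ _ h => Finset.sup_mono (Finset.range_subset_range.2 (by gcongr))

theorem maximalExcess_le_birkhoffSum (T : Ω → Ω) (f g : Ω → ℝ≥0∞) (N : ℕ) (ω : Ω) :
    maximalExcess T f g N ω ≤ birkhoffSum T f N ω :=
  Finset.sup_le fun _ hn => tsub_le_self.trans
    (birkhoffSum_mono_right T f (Finset.mem_range_succ_iff.1 hn) ω)

theorem maximalExcess_add_le {T : Ω → Ω} {f g : Ω → ℝ≥0∞} {N : ℕ} {ω : Ω}
    (h : 0 < maximalExcess T f g N ω) :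
    maximalExcess T f g N ω + g ω ≤ f ω + maximalExcess T f g N (T ω) := by
  obtain ⟨n, hn, hmax⟩ := Finset.exists_mem_eq_sup (Finset.range (N + 1)) ⟨0, by simp⟩
    fun n => birkhoffSum T f n ω - birkhoffSum T g n ω
  change maximalExcess T f g N ω = birkhoffSum T f n ω - birkhoffSum T g n ω at hmax
  rw [hmax] at h ⊢
  cases n with
  | zero => simp at h
  | succ m =>
    have hm : m ∈ Finset.range (N + 1) := by
      simp only [Finset.mem_range] at hn ⊢; omega
    have hle : birkhoffSum T f m (T ω) - birkhoffSum T g m (T ω) ≤ maximalExcess T f g N (T ω) :=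
      Finset.le_sup (f := fun n => birkhoffSum T f n (T ω) - birkhoffSum T g n (T ω)) hm
    rw [birkhoffSum_succ' T f, birkhoffSum_succ' T g, add_comm (g ω), ← tsub_tsub] at h ⊢
    rw [tsub_add_cancel_of_le (tsub_pos_iff_lt.1 h).le]
    exact add_tsub_le_assoc.trans (by gcongr)

theorem birkhoffAverage_indicator_add_compl {n : ℕ} (hn : n ≠ 0) (T : Ω → Ω) (A : Set Ω) (ω : Ω) :
    birkhoffAverage ℝ≥0 T (A.indicator 1) n ω + birkhoffAverage ℝ≥0 T (Aᶜ.indicator 1) n ω =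
      (1 : ℝ≥0∞) := by
  rw [← Pi.add_apply, ← Pi.add_apply, ← birkhoffAverage_add, Set.indicator_self_add_compl]
  simp [birkhoffAverage_eq_div, birkhoffSum, ENNReal.div_self, hn]

theorem liminf_birkhoffAverage_indicator (T : Ω → Ω) (A : Set Ω) (ω : Ω) :
    liminf (fun n => birkhoffAverage ℝ≥0 T (A.indicator (1 : Ω → ℝ≥0∞)) n ω) atTop =
      1 - upperAverage T (Aᶜ.indicator 1) ω := by
  rw [upperAverage, ← ENNReal.liminf_const_sub _ _ ENNReal.one_ne_top]
  refine liminf_congr ((eventually_ne_atTop 0).mono fun n hn => ?_)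
  have hsum := birkhoffAverage_indicator_add_compl hn T A ω
  exact ENNReal.eq_sub_of_add_eq (ne_top_of_le_ne_top ENNReal.one_ne_top (hsum ▸ le_add_self)) hsum

theorem one_le_upperAverage_indicator_add_compl (T : Ω → Ω) (A : Set Ω) (ω : Ω) :
    1 ≤ upperAverage T (A.indicator 1) ω + upperAverage T (Aᶜ.indicator 1) ω := by
  rw [← tsub_le_iff_right, ← liminf_birkhoffAverage_indicator]
  exact liminf_le_limsup

theorem tendsto_birkhoffAverage_indicator {T : Ω → Ω} {A : Set Ω} {ω : Ω}
    (h : upperAverage T (A.indicator 1) ω + upperAverage T (Aᶜ.indicator 1) ω = 1) :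
    Tendsto (fun n => birkhoffAverage ℝ≥0 T (A.indicator 1) n ω) atTop
      (𝓝 (upperAverage T (A.indicator 1) ω)) := by
  refine tendsto_of_le_liminf_of_limsup_le ?_ le_rfl
  rw [liminf_birkhoffAverage_indicator]
  have hfin : upperAverage T (Aᶜ.indicator 1) ω ≠ ∞ :=
    ne_top_of_le_ne_top ENNReal.one_ne_top (h ▸ le_add_self)
  exact (ENNReal.eq_sub_of_add_eq hfin h).le

variable [MeasurableSpace Ω] {P : Measure Ω} {T : Ω → Ω} {f g : Ω → ℝ≥0∞}

theorem measurable_birkhoffSum (hT : Measurable T) (hf : Measurable f) (n : ℕ) :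
    Measurable (birkhoffSum T f n) :=
  Finset.measurable_fun_sum _ fun k _ => hf.comp (hT.iterate k)

theorem measurable_birkhoffAverage (hT : Measurable T) (hf : Measurable f) (n : ℕ) :
    Measurable (birkhoffAverage ℝ≥0 T f n) :=
  (measurable_birkhoffSum hT hf n).const_smul _

theorem measurable_upperAverage (hT : Measurable T) (hf : Measurable f) :
    Measurable (upperAverage T f) :=
  .limsup fun n => measurable_birkhoffAverage hT hf n

theorem measurable_maximalExcess (hT : Measurable T) (hf : Measurable f) (hg : Measurable g)
    (N : ℕ) : Measurable (maximalExcess T f g N) := by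
  unfold maximalExcess
  simp only [Finset.sup_eq_iSup]
  exact .iSup fun n => .iSup fun _ =>
    (measurable_birkhoffSum hT hf n).sub (measurable_birkhoffSum hT hg n)

theorem lintegral_birkhoffSum (hT : MeasurePreserving T P P) (hf : Measurable f) (n : ℕ) :
    ∫⁻ ω, birkhoffSum T f n ω ∂P = n * ∫⁻ ω, f ω ∂P := by
  simp only [birkhoffSum]
  rw [lintegral_finsetSum (f := fun k ω => f (T^[k] ω)) _
    fun k _ => hf.comp (hT.measurable.iterate k)]
  simp [(hT.iterate _).lintegral_comp hf]

theorem setLIntegral_maximalExcess_pos_le (hT : MeasurePreserving T P P) (hf : Measurable f)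
    (hg : Measurable g) (N : ℕ) :
    ∫⁻ ω in {ω | 0 < maximalExcess T f g N ω}, g ω ∂P ≤ ∫⁻ ω, f ω ∂P := by
  rcases eq_or_ne (∫⁻ ω, f ω ∂P) ∞ with hfin | hfin
  · simp [hfin]
  set F := maximalExcess T f g N
  have hF : Measurable F := measurable_maximalExcess hT.measurable hf hg N
  have hFfin : ∫⁻ ω, F ω ∂P ≠ ∞ := by
    refine ne_top_of_le_ne_top (b := ∫⁻ ω, birkhoffSum T f N ω ∂P) ?_
      (lintegral_mono (maximalExcess_le_birkhoffSum T f g N))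
    rw [lintegral_birkhoffSum hT hf]
    finiteness
  have hpointwise : ∀ ω, F ω + {ω | 0 < F ω}.indicator g ω ≤ f ω + F (T ω) := fun ω => by
    by_cases h : 0 < F ω
    · simpa [h] using maximalExcess_add_le h
    · simp [nonpos_iff_eq_zero.1 (not_lt.1 h)]
  have hint := lintegral_mono (μ := P) hpointwise
  rw [lintegral_add_left hF, lintegral_indicator (measurableSet_lt measurable_const hF),
    lintegral_add_left hf, hT.lintegral_comp hF, add_comm] at hint
  exact (ENNReal.add_le_add_iff_right hFfin).1 hint

theorem setLIntegral_exists_birkhoffSum_lt_le (hT : MeasurePreserving T P P) (hf : Measurable f)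
    (hg : Measurable g) :
    ∫⁻ ω in {ω | ∃ n, birkhoffSum T g n ω < birkhoffSum T f n ω}, g ω ∂P ≤ ∫⁻ ω, f ω ∂P := by
  have hset : {ω | ∃ n, birkhoffSum T g n ω < birkhoffSum T f n ω} =
      ⋃ N, {ω | 0 < maximalExcess T f g N ω} := by
    ext ω
    simp only [maximalExcess, Finset.lt_sup_iff, Finset.mem_range, tsub_pos_iff_lt,
      Set.mem_ofPred_eq, Set.mem_iUnion]
    exact ⟨fun ⟨n, hn⟩ => ⟨n, n, n.lt_succ_self, hn⟩, fun ⟨_, n, _, hn⟩ => ⟨n, hn⟩⟩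
  have hmono : Monotone fun N => {ω | 0 < maximalExcess T f g N ω} :=
    fun _ _ h ω hω => lt_of_lt_of_le hω (maximalExcess_mono T f g ω h)
  rw [hset, setLIntegral_iUnion_of_directed _ hmono.directed_le]
  exact iSup_le (setLIntegral_maximalExcess_pos_le hT hf hg)

theorem lintegral_le_of_lt_upperAverage (hT : MeasurePreserving T P P) (hf : Measurable f)
    (hg : Measurable g) (hgT : ∀ ω, g (T ω) ≤ g ω)
    (hlt : ∀ ω, g ω ≠ 0 → g ω < upperAverage T f ω) :
    ∫⁻ ω, g ω ∂P ≤ ∫⁻ ω, f ω ∂P := by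
  have hsupp : Function.support g ⊆ {ω | ∃ n, birkhoffSum T g n ω < birkhoffSum T f n ω} :=
    fun ω hω => exists_birkhoffSum_lt_of_lt_upperAverage hgT (hlt ω hω)
  rw [← setLIntegral_eq_of_support_subset hsupp]
  exact setLIntegral_exists_birkhoffSum_lt_le hT hf hg

theorem lintegral_upperAverage_le (hT : MeasurePreserving T P P) (hf : Measurable f) :
    ∫⁻ ω, upperAverage T f ω ∂P ≤ ∫⁻ ω, f ω ∂P := by
  have hmeas := measurable_upperAverage hT.measurable hf
  have htruncated (k : ℕ) : ∫⁻ ω, min (upperAverage T f ω) k ∂P ≤ ∫⁻ ω, f ω ∂P := by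
    refine ENNReal.le_of_forall_lt_one_mul_le fun θ hθ => ?_
    rw [← lintegral_const_mul _ (hmeas.min measurable_const)]
    refine lintegral_le_of_lt_upperAverage hT hf ((hmeas.min measurable_const).const_mul θ)
      (fun ω => ?_) fun ω hω => ?_
    · gcongr
      exact upperAverage_comp_le T f ω
    · have hfin : min (upperAverage T f ω) k ≠ ∞ := by simp
      calc θ * min (upperAverage T f ω) k < 1 * min (upperAverage T f ω) k :=
            ENNReal.mul_lt_mul_left (right_ne_zero_of_mul hω) hfin hθ
        _ ≤ upperAverage T f ω := by simp
  have hsup (ω : Ω) : upperAverage T f ω = ⨆ k : ℕ, min (upperAverage T f ω) k := by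
    rw [← inf_iSup_eq, ENNReal.iSup_natCast, inf_top_eq]
  rw [lintegral_congr hsup, lintegral_iSup (fun k => hmeas.min measurable_const)
    fun k l hkl ω => by gcongr]
  exact iSup_le htruncated

theorem ae_upperAverage_comp_eq (hT : MeasurePreserving T P P) (hf : Measurable f)
    (hfin : ∫⁻ ω, f ω ∂P ≠ ∞) : ∀ᵐ ω ∂P, upperAverage T f (T ω) = upperAverage T f ω := by
  have hmeas := measurable_upperAverage hT.measurable hf
  have hinvariant := hT.lintegral_comp hmeas
  refine ae_eq_of_ae_le_of_lintegral_le (.of_forall (upperAverage_comp_le T f)) ?_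
    hmeas.aemeasurable hinvariant.ge
  rw [hinvariant]
  exact ne_top_of_le_ne_top hfin (lintegral_upperAverage_le hT hf)

variable [IsProbabilityMeasure P] {A : Set Ω}

theorem ae_upperAverage_indicator_add_compl (hT : MeasurePreserving T P P) (hA : MeasurableSet A) :
    ∀ᵐ ω ∂P, upperAverage T (A.indicator 1) ω + upperAverage T (Aᶜ.indicator 1) ω = 1 := by
  have h1 : Measurable (A.indicator (1 : Ω → ℝ≥0∞)) := measurable_one.indicator hA
  have h2 : Measurable (Aᶜ.indicator (1 : Ω → ℝ≥0∞)) := measurable_one.indicator hA.compl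
  have hle : ∫⁻ ω, upperAverage T (A.indicator 1) ω + upperAverage T (Aᶜ.indicator 1) ω ∂P ≤
      ∫⁻ _, 1 ∂P := by
    rw [lintegral_add_left (measurable_upperAverage hT.measurable h1)]
    refine (add_le_add (lintegral_upperAverage_le hT h1) (lintegral_upperAverage_le hT h2)).trans ?_
    rw [← lintegral_add_left h1]
    exact (lintegral_congr fun ω => Set.indicator_self_add_compl_apply A 1 ω).le
  filter_upwards [ae_eq_of_ae_le_of_lintegral_le
    (.of_forall (one_le_upperAverage_indicator_add_compl T A)) (by simp)
    ((measurable_upperAverage hT.measurable h1).add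
      (measurable_upperAverage hT.measurable h2)).aemeasurable hle] with ω hω
  exact hω.symm

theorem ae_tendsto_birkhoffAverage_indicator (hT : MeasurePreserving T P P)
    (hA : MeasurableSet A) :
    ∀ᵐ ω ∂P, Tendsto (fun n => birkhoffAverage ℝ≥0 T (A.indicator 1) n ω) atTop
      (𝓝 (upperAverage T (A.indicator 1) ω)) :=
  (ae_upperAverage_indicator_add_compl hT hA).mono fun _ => tendsto_birkhoffAverage_indicator

end ErgodicAverages

section Wasserstein

variable {M : Type*} [MeasurableSpace M]

theorem isCoupling_map {Ω : Type*} [MeasurableSpace Ω] (P : Measure Ω) {f g : Ω → M}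
    (hf : Measurable f) (hg : Measurable g) :
    IsCoupling (P.map fun ω => (f ω, g ω)) (P.map f) (P.map g) :=
  ⟨by rw [Measure.map_map measurable_fst (hf.prodMk hg)]; rfl,
    by rw [Measure.map_map measurable_snd (hf.prodMk hg)]; rfl⟩

theorem IsCoupling.add {π₁ π₂ : Measure (M × M)} {μ₁ μ₂ ν₁ ν₂ : Measure M}
    (h₁ : IsCoupling π₁ μ₁ ν₁) (h₂ : IsCoupling π₂ μ₂ ν₂) :
    IsCoupling (π₁ + π₂) (μ₁ + μ₂) (ν₁ + ν₂) :=
  ⟨by rw [Measure.map_add _ _ measurable_fst, h₁.1, h₂.1],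
    by rw [Measure.map_add _ _ measurable_snd, h₁.2, h₂.2]⟩

theorem isCoupling_inv_smul_prod {μ ν : Measure M} [IsFiniteMeasure μ] [IsFiniteMeasure ν]
    (h : μ Set.univ = ν Set.univ) : IsCoupling ((μ Set.univ)⁻¹ • μ.prod ν) μ ν := by
  rcases eq_or_ne (μ Set.univ) 0 with h0 | h0
  · rw [h0, eq_comm, Measure.measure_univ_eq_zero] at h
    rw [Measure.measure_univ_eq_zero] at h0
    simp [h0, h, IsCoupling]
  · have hinv : (μ Set.univ)⁻¹ * μ Set.univ = 1 := ENNReal.inv_mul_cancel h0 (by finiteness)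
    constructor
    · rw [Measure.map_smul, Measure.map_fst_prod, smul_smul, ← h, hinv, one_smul]
    · rw [Measure.map_smul, Measure.map_snd_prod, smul_smul, hinv, one_smul]

theorem sum_measure_singleton_eq_one [MeasurableSingletonClass M] {F : Finset M} {μ : Measure M}
    [IsProbabilityMeasure μ] (hμ : ∀ᵐ a ∂μ, a ∈ F) : ∑ a ∈ F, μ {a} = 1 := by
  rw [sum_measure_singleton]
  exact (prob_compl_eq_zero_iff F.measurableSet).1 hμ

theorem sum_smul_dirac_le [MeasurableSingletonClass M] {F : Finset M} {μ : Measure M}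
    {w : M → ℝ≥0∞} (hw : ∀ a ∈ F, w a ≤ μ {a}) :
    ∑ a ∈ F, w a • Measure.dirac a ≤ μ := by
  classical
  refine Measure.le_iff.2 fun s hs => ?_
  calc (∑ a ∈ F, w a • Measure.dirac a) s = ∑ a ∈ F with a ∈ s, w a := by
        simp [Measure.coe_finsetSum, Finset.sum_filter, Measure.dirac_apply' _ hs,
          Set.indicator_apply]
    _ ≤ ∑ a ∈ F with a ∈ s, μ {a} :=
        Finset.sum_le_sum fun a ha => hw a (Finset.mem_of_mem_filter a ha)
    _ = μ ({a ∈ F | a ∈ s} : Finset M) := sum_measure_singleton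
    _ ≤ μ s := measure_mono fun a ha => (Finset.mem_filter.1 ha).2

theorem tupleMeasure_eq_map {n : ℕ} (x : Fin n → M) :
    tupleMeasure x = ((n : ℝ≥0∞)⁻¹ • Measure.count : Measure (Fin n)).map x := by
  rw [Measure.map_smul, Measure.count, Measure.map_sum (by fun_prop), Measure.sum_fintype]
  simp only [Measure.map_dirac' (measurable_of_finite x), tupleMeasure]

variable [MetricSpace M] {p : ℝ}

theorem wasserstein_le_of_isCoupling (hp : 0 ≤ p) {μ ν : Measure M} {π : Measure (M × M)}
    (h : IsCoupling π μ ν) :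
    wasserstein p μ ν ≤ (∫⁻ z, edist z.1 z.2 ^ p ∂π) ^ (1 / p) :=
  ENNReal.rpow_le_rpow (iInf_le_of_le ⟨π, h⟩ le_rfl) (by positivity)

theorem wasserstein_map_le (hp : 0 ≤ p) {Ω : Type*} [MeasurableSpace Ω] (P : Measure Ω)
    {f g : Ω → M} (hf : Measurable f) (hg : Measurable g) :
    wasserstein p (P.map f) (P.map g) ≤ (∫⁻ ω, edist (f ω) (g ω) ^ p ∂P) ^ (1 / p) :=
  (wasserstein_le_of_isCoupling hp (isCoupling_map P hf hg)).trans
    (ENNReal.rpow_le_rpow (lintegral_map_le _ _) (by positivity))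

theorem wasserstein_tupleMeasure_le (hp : 0 ≤ p) {n : ℕ} (x y : Fin n → M) :
    wasserstein p (tupleMeasure x) (tupleMeasure y) ≤
      ((n : ℝ≥0∞)⁻¹ * ∑ j, edist (x j) (y j) ^ p) ^ (1 / p) := by
  rw [tupleMeasure_eq_map, tupleMeasure_eq_map]
  refine (wasserstein_map_le hp _ (measurable_of_finite x) (measurable_of_finite y)).trans_eq ?_
  rw [lintegral_smul_measure, lintegral_count, tsum_fintype, smul_eq_mul]

theorem lintegral_prod_edist_rpow_le (hp : 0 ≤ p) {μ ν : Measure M} [IsFiniteMeasure μ]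
    [IsFiniteMeasure ν] {s : Set M} (hμ : ∀ᵐ a ∂μ, a ∈ s) (hν : ∀ᵐ a ∂ν, a ∈ s) :
    ∫⁻ z, edist z.1 z.2 ^ p ∂μ.prod ν ≤
      Metric.ediam s ^ p * (μ Set.univ * ν Set.univ) := by
  rw [← Measure.prod_prod, Set.univ_prod_univ, ← lintegral_const]
  refine lintegral_mono_ae ?_
  filter_upwards [Measure.quasiMeasurePreserving_fst.ae hμ,
    Measure.quasiMeasurePreserving_snd.ae hν] with z h1 h2
  exact ENNReal.rpow_le_rpow (Metric.edist_le_ediam_of_mem h1 h2) hp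

theorem wasserstein_le_of_common_le (hp : 0 < p) {κ μ ν : Measure M} [IsProbabilityMeasure μ]
    [IsProbabilityMeasure ν] {s : Set M} (hμ : ∀ᵐ a ∂μ, a ∈ s) (hν : ∀ᵐ a ∂ν, a ∈ s)
    (hκμ : κ ≤ μ) (hκν : κ ≤ ν) :
    wasserstein p μ ν ≤ (Metric.ediam s ^ p * (1 - κ Set.univ)) ^ (1 / p) := by
  have : IsFiniteMeasure κ := isFiniteMeasure_of_le μ hκμ
  have hmass {ρ : Measure M} [IsProbabilityMeasure ρ] (h : κ ≤ ρ) :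
      (ρ - κ) Set.univ = 1 - κ Set.univ := by rw [Measure.sub_apply .univ h, measure_univ]
  have hcoupling : IsCoupling (κ.map (fun a => (a, a)) +
      ((μ - κ) Set.univ)⁻¹ • (μ - κ).prod (ν - κ)) μ ν := by
    have h := (isCoupling_map κ measurable_id measurable_id).add
      (isCoupling_inv_smul_prod ((hmass hκμ).trans (hmass hκν).symm))
    rwa [Measure.map_id, add_comm κ, Measure.sub_add_cancel_of_le hκμ, add_comm κ,
      Measure.sub_add_cancel_of_le hκν] at h
  have hdiag : ∫⁻ z : M × M, edist z.1 z.2 ^ p ∂κ.map (fun a => (a, a)) = 0 :=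
    nonpos_iff_eq_zero.1 ((lintegral_map_le _ _).trans (by simp [hp]))
  have hprod := lintegral_prod_edist_rpow_le hp.le
    (ae_mono (Measure.sub_le (μ := μ) (ν := κ)) hμ)
    (ae_mono (Measure.sub_le (μ := ν) (ν := κ)) hν)
  refine (wasserstein_le_of_isCoupling hp.le hcoupling).trans
    (ENNReal.rpow_le_rpow ?_ (by positivity))
  rw [lintegral_add_measure, hdiag, zero_add, lintegral_smul_measure, smul_eq_mul]
  rw [hmass hκμ, hmass hκν] at hprod
  rw [hmass hκμ]
  calc (1 - κ Set.univ)⁻¹ * ∫⁻ z, edist z.1 z.2 ^ p ∂(μ - κ).prod (ν - κ)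
      ≤ (1 - κ Set.univ)⁻¹ * (Metric.ediam s ^ p * ((1 - κ Set.univ) * (1 - κ Set.univ))) := by
        gcongr
    _ = Metric.ediam s ^ p * (1 - κ Set.univ) *
          ((1 - κ Set.univ)⁻¹ * (1 - κ Set.univ)) := by ring
    _ ≤ Metric.ediam s ^ p * (1 - κ Set.univ) :=
        mul_le_of_le_one_right' (ENNReal.inv_mul_le_one _)

variable [MeasurableSingletonClass M] {F : Finset M}

theorem wasserstein_le_of_forall_mem_finset (hp : 0 < p) {μ ν : Measure M}
    [IsProbabilityMeasure μ] [IsProbabilityMeasure ν] (hμ : ∀ᵐ a ∂μ, a ∈ F)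
    (hν : ∀ᵐ a ∂ν, a ∈ F) :
    wasserstein p μ ν ≤
      (Metric.ediam (F : Set M) ^ p * (1 - ∑ a ∈ F, min (μ {a}) (ν {a}))) ^ (1 / p) := by
  have h := wasserstein_le_of_common_le hp (s := F) hμ hν
    (sum_smul_dirac_le (F := F) fun a _ => min_le_left (μ {a}) (ν {a}))
    (sum_smul_dirac_le (F := F) fun a _ => min_le_right (μ {a}) (ν {a}))
  simpa [Measure.coe_finsetSum] using h

theorem tendsto_wasserstein_of_tendsto_sum_min (hp : 0 < p) {ι : Type*} {l : Filter ι}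
    {μ ν : ι → Measure M} [∀ i, IsProbabilityMeasure (μ i)] [∀ i, IsProbabilityMeasure (ν i)]
    (hμ : ∀ i, ∀ᵐ a ∂μ i, a ∈ F) (hν : ∀ i, ∀ᵐ a ∂ν i, a ∈ F)
    (h : Tendsto (fun i => ∑ a ∈ F, min (μ i {a}) (ν i {a})) l (𝓝 1)) :
    Tendsto (fun i => wasserstein p (μ i) (ν i)) l (𝓝 0) := by
  have hmoved : Tendsto (fun i => 1 - ∑ a ∈ F, min (μ i {a}) (ν i {a})) l (𝓝 0) := by
    simpa using ENNReal.Tendsto.sub tendsto_const_nhds h (.inl ENNReal.one_ne_top)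
  have hbound := (ENNReal.Tendsto.const_mul hmoved (.inr (ENNReal.rpow_ne_top_of_nonneg hp.le
    F.finite_toSet.isBounded.ediam_ne_top))).ennrpow_const (1 / p)
  rw [mul_zero, ENNReal.zero_rpow_of_pos (by positivity)] at hbound
  exact tendsto_of_tendsto_of_tendsto_of_le_of_le tendsto_const_nhds hbound (fun _ => zero_le)
    fun i => wasserstein_le_of_forall_mem_finset hp (hμ i) (hν i)

theorem tendsto_wasserstein_of_tendsto_singleton (hp : 0 < p) {ι : Type*} {l : Filter ι}
    {μ ν : ι → Measure M} [∀ i, IsProbabilityMeasure (μ i)] [∀ i, IsProbabilityMeasure (ν i)]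
    (hμ : ∀ i, ∀ᵐ a ∂μ i, a ∈ F) (hν : ∀ i, ∀ᵐ a ∂ν i, a ∈ F) {w : M → ℝ≥0∞}
    (hμw : ∀ a ∈ F, Tendsto (fun i => μ i {a}) l (𝓝 (w a)))
    (hνw : ∀ a ∈ F, Tendsto (fun i => ν i {a}) l (𝓝 (w a))) :
    Tendsto (fun i => wasserstein p (μ i) (ν i)) l (𝓝 0) := by
  rcases l.eq_or_neBot with rfl | _
  · exact tendsto_bot
  have hw : ∑ a ∈ F, w a = 1 :=
    tendsto_nhds_unique (tendsto_finsetSum F hμw)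
      (by simp only [fun i => sum_measure_singleton_eq_one (hμ i), tendsto_const_nhds_iff])
  refine tendsto_wasserstein_of_tendsto_sum_min hp hμ hν ?_
  simpa only [min_self, hw] using tendsto_finsetSum F fun a ha => (hμw a ha).min (hνw a ha)

end Wasserstein

section Quantization

theorem exists_le_card_fiber {α : Type*} [Fintype α] [Nonempty α] [DecidableEq α] {n : ℕ}
    {c : α → ℕ} (hc : ∑ a, c a ≤ n) :
    ∃ x : Fin n → α, ∀ a, c a ≤ (Finset.univ.filter fun k => x k = a).card := by
  obtain ⟨e⟩ : Nonempty ((Σ a, Fin (c a)) ↪ Fin n) :=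
    Function.Embedding.nonempty_of_card_le (by simpa using hc)
  refine ⟨Function.extend e Sigma.fst fun _ => Classical.arbitrary α, fun a => ?_⟩
  have hmaps (i : Fin (c a)) : e ⟨a, i⟩ ∈ Finset.univ.filter fun k =>
      Function.extend e Sigma.fst (fun _ => Classical.arbitrary α) k = a := by
    simp [e.injective.extend_apply]
  simpa using Finset.card_le_card_of_injOn (s := Finset.univ) _ (fun i _ => hmaps i)
    (e.injective.comp sigma_mk_injective).injOn

theorem natFloor_toReal_mul_le {w : ℝ≥0∞} (hw : w ≠ ∞) (n : ℕ) :
    (⌊w.toReal * n⌋₊ : ℝ≥0∞) ≤ w * n := by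
  rw [← ENNReal.toReal_le_toReal (by simp) (by finiteness)]
  simpa using Nat.floor_le (by positivity)

theorem tendsto_natFloor_toReal_mul_div {w : ℝ≥0∞} (hw : w ≠ ∞) :
    Tendsto (fun n : ℕ => (⌊w.toReal * n⌋₊ : ℝ≥0∞) / n) atTop (𝓝 w) := by
  refine (ENNReal.tendsto_toReal_iff (fun n => ?_) hw).1 ?_
  · rcases eq_or_ne n 0 with rfl | hn
    · simp
    · finiteness
  · simpa [Function.comp_def] using
      (tendsto_nat_floor_mul_div_atTop w.toReal_nonneg).comp tendsto_natCast_atTop_atTop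

variable {M : Type*} [MeasurableSpace M]

theorem tupleMeasure_apply {n : ℕ} (x : Fin n → M) {s : Set M} (hs : MeasurableSet s) :
    tupleMeasure x s = (∑ k, s.indicator 1 (x k)) / n := by
  simp [tupleMeasure, Measure.coe_finsetSum, Measure.dirac_apply' _ hs, ENNReal.div_eq_inv_mul]

theorem ae_mem_tupleMeasure {n : ℕ} {x : Fin n → M} {s : Set M} (hs : MeasurableSet s)
    (hx : ∀ k, x k ∈ s) : ∀ᵐ a ∂tupleMeasure x, a ∈ s := by
  rw [ae_iff]
  refine (tupleMeasure_apply x hs.compl).trans ?_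
  simp [hx]

theorem exists_natFloor_div_le_tupleMeasure [MeasurableSingletonClass M] {F : Finset M}
    {μ : Measure M} [IsProbabilityMeasure μ] (hμ : ∀ᵐ a ∂μ, a ∈ F) (n : ℕ) :
    ∃ x : Fin n → M, (∀ k, x k ∈ F) ∧
      ∀ a ∈ F, (⌊(μ {a}).toReal * n⌋₊ : ℝ≥0∞) / n ≤ tupleMeasure x {a} := by
  classical
  have hmass : ∑ a : F, μ {(a : M)} = 1 := by
    rw [Finset.sum_coe_sort F fun a => μ {a}, sum_measure_singleton_eq_one hμ]
  have : Nonempty F := by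
    by_contra h
    rw [not_nonempty_iff] at h
    simp at hmass
  have hsum : ∑ a : F, ⌊(μ {(a : M)}).toReal * n⌋₊ ≤ n := by
    have h : ∑ a : F, (⌊(μ {(a : M)}).toReal * n⌋₊ : ℝ≥0∞) ≤ ∑ a : F, μ {(a : M)} * n :=
      Finset.sum_le_sum fun a _ => natFloor_toReal_mul_le (by finiteness) n
    rw [← Finset.sum_mul, hmass, one_mul] at h
    exact_mod_cast h
  obtain ⟨x, hx⟩ := exists_le_card_fiber hsum
  refine ⟨fun k => x k, fun k => (x k).2, fun a ha => ?_⟩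
  rw [tupleMeasure_apply _ (measurableSet_singleton a)]
  gcongr
  calc (⌊(μ {a}).toReal * n⌋₊ : ℝ≥0∞) ≤ (Finset.univ.filter fun k => x k = ⟨a, ha⟩).card :=
        Nat.cast_le.2 (hx ⟨a, ha⟩)
    _ = ∑ k, ({a} : Set M).indicator 1 (x k : M) := by
        simp [Set.indicator_apply, Subtype.ext_iff]

variable [MetricSpace M] [BorelSpace M] {p : ℝ} [hp : Fact (1 ≤ p)]

instance (μ : PMeas M p) : IsProbabilityMeasure μ.1 := μ.2.isProbabilityMeasure

theorem exists_tendsto_wasserstein_tupleP {F : Finset M} (μ : PMeas M p)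
    (hμ : ∀ᵐ a ∂μ.1, a ∈ F) :
    ∃ x : ∀ n, Fin (n + 1) → M, (∀ n k, x n k ∈ F) ∧
      Tendsto (fun n => wasserstein p (tupleP p (x n)).1 μ.1) atTop (𝓝 0) := by
  choose x hxF hx using fun n => exists_natFloor_div_le_tupleMeasure hμ (n + 1)
  refine ⟨x, hxF, tendsto_wasserstein_of_tendsto_sum_min (zero_lt_one.trans_le hp.out) (F := F)
    (fun n => ae_mem_tupleMeasure F.measurableSet (hxF n)) (fun _ => hμ) ?_⟩
  have hlower : Tendsto
      (fun n => ∑ a ∈ F, (⌊(μ.1 {a}).toReal * (n + 1 : ℕ)⌋₊ : ℝ≥0∞) / (n + 1 : ℕ))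
      atTop (𝓝 1) := by
    rw [← sum_measure_singleton_eq_one hμ]
    exact tendsto_finsetSum _ fun a _ =>
      (tendsto_natFloor_toReal_mul_div (by finiteness)).comp (tendsto_add_atTop_nat 1)
  refine tendsto_of_tendsto_of_tendsto_of_le_of_le hlower tendsto_const_nhds
    (fun n => Finset.sum_le_sum fun a ha => le_min (hx n a ha) ?_) fun n => ?_
  · exact ENNReal.div_le_of_le_mul (natFloor_toReal_mul_le (by finiteness) _)
  · exact (Finset.sum_le_sum fun a _ => min_le_right _ _).trans_eq
      (sum_measure_singleton_eq_one hμ)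

end Quantization

section Barycenters

variable {M : Type*} [MetricSpace M] [MeasurableSpace M] [BorelSpace M] {p : ℝ} [hp : Fact (1 ≤ p)]

theorem edist_tupleP_le (β : BaryMap M p) {n : ℕ} (x y : Fin (n + 1) → M) :
    edist (β (tupleP p x)) (β (tupleP p y)) ≤
      (((n + 1 : ℕ) : ℝ≥0∞)⁻¹ * ∑ j, edist (x j) (y j) ^ p) ^ (1 / p) :=
  (β.contractive _ _).trans (wasserstein_tupleMeasure_le (zero_le_one.trans hp.out) x y)

theorem continuous_tupleP (β : BaryMap M p) (n : ℕ) :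
    Continuous fun x : Fin (n + 1) → M => β (tupleP p x) := by
  have hp0 : 0 < p := zero_lt_one.trans_le hp.out
  refine LipschitzWith.continuous (K := 1) fun x y => (edist_tupleP_le β x y).trans ?_
  rw [ENNReal.coe_one, one_mul, one_div, ENNReal.rpow_inv_le_iff hp0]
  calc ((n + 1 : ℕ) : ℝ≥0∞)⁻¹ * ∑ j, edist (x j) (y j) ^ p
      ≤ ((n + 1 : ℕ) : ℝ≥0∞)⁻¹ * ∑ _j : Fin (n + 1), edist x y ^ p := by
        gcongr with j
        exact edist_le_pi_edist x y j
    _ = edist x y ^ p := by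
        rw [Finset.sum_const, Finset.card_univ, Fintype.card_fin, nsmul_eq_mul, ← mul_assoc,
          ENNReal.inv_mul_cancel (by simp) (by finiteness), one_mul]

theorem tupleP_const (n : ℕ) (x : M) : tupleP p (fun _ : Fin (n + 1) => x) = diracP p x := by
  refine Subtype.ext ?_
  simp only [tupleP, diracP, tupleMeasure, Finset.sum_const, Finset.card_univ, Fintype.card_fin]
  rw [← Nat.cast_smul_eq_nsmul ℝ≥0∞, smul_smul, ENNReal.inv_mul_cancel (by simp) (by finiteness),
    one_smul]

theorem edist_tupleP_le_mul_ediam (β β' : BaryMap M p) {n : ℕ} (x : Fin (n + 1) → M) :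
    edist (β (tupleP p x)) (β' (tupleP p x)) ≤ edist β β' * Metric.ediam (Set.range x) := by
  rcases eq_or_ne (Metric.ediam (Set.range x)) 0 with h | h
  · have hx : x = fun _ => x 0 := by
      ext j
      exact Metric.ediam_eq_zero_iff.1 h ⟨j, rfl⟩ ⟨0, rfl⟩
    rw [hx, tupleP_const, β.map_dirac, β'.map_dirac, edist_self]
    exact zero_le
  · have hfin : Metric.ediam (Set.range x) ≠ ∞ :=
      (Set.finite_range x).isBounded.ediam_ne_top
    rw [← ENNReal.div_le_iff h hfin]
    exact le_iSup_of_le n (le_iSup_of_le x (le_iSup_of_le h le_rfl))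

theorem edist_apply_le_mul_ediam (β β' : BaryMap M p) {F : Finset M} (μ : PMeas M p)
    (hμ : ∀ᵐ a ∂μ.1, a ∈ F) :
    edist (β μ) (β' μ) ≤ edist β β' * Metric.ediam (F : Set M) := by
  obtain ⟨x, hxF, hx⟩ := exists_tendsto_wasserstein_tupleP μ hμ
  have hlim (γ : BaryMap M p) : Tendsto (fun n => γ (tupleP p (x n))) atTop (𝓝 (γ μ)) :=
    tendsto_iff_edist_tendsto_0.2 (tendsto_of_tendsto_of_tendsto_of_le_of_le tendsto_const_nhds hx
      (fun _ => zero_le) fun n => γ.contractive _ _)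
  refine le_of_tendsto' ((hlim β).edist (hlim β')) fun n => ?_
  refine (edist_tupleP_le_mul_ediam β β' (x n)).trans ?_
  gcongr
  exact Set.range_subset_iff.2 (hxF n)

end Barycenters

section LpSpace

variable {Ω M : Type*} [MeasurableSpace Ω] [MetricSpace M] {p : ℝ} {P : Measure Ω}

theorem measurable_edist_of_stronglyMeasurable {f g : Ω → M} (hf : StronglyMeasurable f)
    (hg : StronglyMeasurable g) : Measurable fun ω => edist (f ω) (g ω) :=
  (continuous_edist.comp_stronglyMeasurable (hf.prodMk hg)).measurable

theorem LpMap.stronglyMeasurable (f : LpMap M p P) : StronglyMeasurable f :=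
  f.1.stronglyMeasurable

theorem LpMap.measurable_edist (f g : LpMap M p P) : Measurable fun ω => edist (f ω) (g ω) :=
  measurable_edist_of_stronglyMeasurable f.stronglyMeasurable g.stronglyMeasurable

theorem LpMap.edist_rpow [hp : Fact (1 ≤ p)] (f g : LpMap M p P) :
    edist f g ^ p = ∫⁻ ω, edist (f ω) (g ω) ^ p ∂P := by
  rw [← ENNReal.rpow_inv_rpow (zero_lt_one.trans_le hp.out).ne' (∫⁻ ω, _ ∂P), ← one_div]
  rfl

theorem LpMap.edist_le_of_ae_le [hp : Fact (1 ≤ p)] [IsProbabilityMeasure P] {f g : LpMap M p P}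
    {c : ℝ≥0∞} (h : ∀ᵐ ω ∂P, edist (f ω) (g ω) ≤ c) : edist f g ≤ c := by
  have hp0 : 0 < p := zero_lt_one.trans_le hp.out
  rw [← ENNReal.rpow_le_rpow_iff hp0, LpMap.edist_rpow]
  calc ∫⁻ ω, edist (f ω) (g ω) ^ p ∂P ≤ ∫⁻ _, c ^ p ∂P :=
        lintegral_mono_ae (h.mono fun ω hω => ENNReal.rpow_le_rpow hω hp0.le)
    _ = c ^ p := by simp

/-- The class of an a.e. strongly measurable map with finite `p`-th moment about `x`. -/
def LpMap.ofFun (f : Ω → M) (hf : AEStronglyMeasurable f P) (x : M)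
    (hx : ∫⁻ ω, edist x (f ω) ^ p ∂P < ∞) : LpMap M p P :=
  ⟨AEEqFun.mk f hf, x, by
    refine (lintegral_congr_ae ?_).trans_lt hx
    filter_upwards [AEEqFun.coeFn_mk f hf] with ω hω
    rw [hω]⟩

theorem LpMap.coeFn_ofFun {f : Ω → M} (hf : AEStronglyMeasurable f P) {x : M}
    (hx : ∫⁻ ω, edist x (f ω) ^ p ∂P < ∞) : LpMap.ofFun f hf x hx =ᵐ[P] f :=
  AEEqFun.coeFn_mk f hf

/-- The constant map `x` as an element of `L^p(Ω; M)`. -/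
def LpMap.const (p : ℝ) [hp : Fact (1 ≤ p)] (P : Measure Ω) (x : M) : LpMap M p P :=
  ⟨AEEqFun.const Ω x, x, by
    refine (lintegral_congr_ae (g := 0) ?_).trans_lt (by simp)
    filter_upwards [AEEqFun.coeFn_const Ω x (μ := P)] with ω hω
    simp [hω, zero_lt_one.trans_le hp.out]⟩

theorem LpMap.const_apply [Fact (1 ≤ p)] [NeZero P] (x : M) (ω : Ω) : LpMap.const p P x ω = x :=
  AEEqFun.coeFn_const_eq _ x ω

/-- The elements of `L^p(Ω; M)` almost all of whose values lie in a fixed finite set. -/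
def LpMap.finitelyValued : Set (LpMap M p P) :=
  {f | ∃ F : Finset M, ∀ᵐ ω ∂P, f ω ∈ F}

section Density

variable [MeasurableSpace M] [BorelSpace M] {f : Ω → M} {A : Set M}
  [TopologicalSpace.SeparableSpace A] {x : M}

theorem lintegral_edist_approxOn_lt_top (hp : 1 ≤ p) (hf : StronglyMeasurable f) (hxA : x ∈ A)
    (hx : ∫⁻ ω, edist x (f ω) ^ p ∂P < ∞) (n : ℕ) :
    ∫⁻ ω, edist x (SimpleFunc.approxOn f hf.measurable A x hxA n ω) ^ p ∂P < ∞ := by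
  have hp0 : 0 ≤ p := zero_le_one.trans hp
  calc ∫⁻ ω, edist x (SimpleFunc.approxOn f hf.measurable A x hxA n ω) ^ p ∂P
      ≤ ∫⁻ ω, (edist x (f ω) + edist x (f ω)) ^ p ∂P := by
        gcongr with ω
        exact SimpleFunc.edist_approxOn_y0_le hf.measurable hxA ω n
    _ = 2 ^ p * ∫⁻ ω, edist x (f ω) ^ p ∂P := by
        simp only [← two_mul, ENNReal.mul_rpow_of_nonneg _ _ hp0]
        exact lintegral_const_mul' _ _ (by finiteness)
    _ < ∞ := by finiteness

theorem tendsto_lintegral_edist_approxOn (hp : 0 < p) (hf : StronglyMeasurable f) (hxA : x ∈ A)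
    (hfA : ∀ ω, f ω ∈ A) (hx : ∫⁻ ω, edist x (f ω) ^ p ∂P < ∞) :
    Tendsto (fun n => ∫⁻ ω, edist (f ω) (SimpleFunc.approxOn f hf.measurable A x hxA n ω) ^ p ∂P)
      atTop (𝓝 0) := by
  rw [← lintegral_zero (μ := P)]
  refine tendsto_lintegral_of_dominated_convergence (fun ω => edist x (f ω) ^ p) (fun n => ?_)
    (fun n => .of_forall fun ω => ?_) hx.ne (.of_forall fun ω => ?_)
  · exact (measurable_edist_of_stronglyMeasurable hf
      (SimpleFunc.stronglyMeasurable _)).pow_const p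
  · refine ENNReal.rpow_le_rpow ?_ hp.le
    rw [edist_comm]
    exact SimpleFunc.edist_approxOn_le hf.measurable hxA ω n
  · have h := (tendsto_const_nhds (x := f ω)).edist
      (SimpleFunc.tendsto_approxOn hf.measurable hxA (subset_closure (hfA ω)))
    simpa [hp] using h.ennrpow_const p

end Density

theorem LpMap.dense_finitelyValued [hp : Fact (1 ≤ p)] [MeasurableSpace M] [BorelSpace M] :
    Dense (LpMap.finitelyValued : Set (LpMap M p P)) := fun f => by
  have hp0 : 0 < p := zero_lt_one.trans_le hp.out
  obtain ⟨x, hx⟩ := f.2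
  have hf := f.stronglyMeasurable
  have : TopologicalSpace.SeparableSpace ↥({x} ∪ Set.range f) :=
    ((Set.finite_singleton x).isSeparable.union hf.isSeparable_range).separableSpace
  have hxA : x ∈ {x} ∪ Set.range f := .inl rfl
  let S (n : ℕ) : SimpleFunc Ω M := SimpleFunc.approxOn f hf.measurable _ x hxA n
  have hS (n : ℕ) := (S n).aestronglyMeasurable (μ := P)
  have hSx (n : ℕ) := lintegral_edist_approxOn_lt_top hp.out hf hxA hx n
  refine mem_closure_of_tendsto (f := fun n => LpMap.ofFun (S n) (hS n) x (hSx n)) (b := atTop) ?_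
    (.of_forall fun n => ⟨(S n).range, ?_⟩)
  · rw [tendsto_iff_edist_tendsto_0]
    have h := (tendsto_lintegral_edist_approxOn hp0 hf hxA
      (fun ω => .inr ⟨ω, rfl⟩) hx).ennrpow_const (1 / p)
    rw [ENNReal.zero_rpow_of_pos (by positivity)] at h
    refine h.congr fun n => ?_
    rw [edist_comm]
    refine congrArg (· ^ (1 / p)) (lintegral_congr_ae ?_)
    filter_upwards [LpMap.coeFn_ofFun (hS n) (hSx n)] with ω hω
    rw [hω]
  · filter_upwards [LpMap.coeFn_ofFun (hS n) (hSx n)] with ω hω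
    rw [hω]
    exact (S n).mem_range_self ω

end LpSpace

section Convergence

variable {M : Type*} [PseudoEMetricSpace M]

theorem cauchySeq_of_tendsto_edist {u : ℕ → M}
    (h : Tendsto (fun k : ℕ × ℕ => edist (u k.1) (u k.2)) atTop (𝓝 0)) : CauchySeq u :=
  cauchySeq_iff_tendsto.2 (uniformity_basis_edist.tendsto_right_iff.2 fun _ hε =>
    h.eventually (gt_mem_nhds hε))

theorem tendsto_edist_zero_of_approx {ι : Type*} {l : Filter ι} {u v : ι → M}
    (h : ∀ ε > 0, ∃ u' v' : ι → M, Tendsto (fun i => edist (u' i) (v' i)) l (𝓝 0) ∧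
      (∀ᶠ i in l, edist (u i) (u' i) < ε) ∧ ∀ᶠ i in l, edist (v i) (v' i) < ε) :
    Tendsto (fun i => edist (u i) (v i)) l (𝓝 0) := by
  refine ENNReal.tendsto_nhds_zero.2 fun ε hε => ?_
  have hε3 : 0 < ε / 3 := ENNReal.div_pos hε.ne' (by simp)
  obtain ⟨u', v', huv, hu, hv⟩ := h (ε / 3) hε3
  filter_upwards [ENNReal.tendsto_nhds_zero.1 huv _ hε3, hu, hv] with i h1 h2 h3
  rw [← ENNReal.add_thirds ε]
  refine (edist_triangle4 _ (u' i) (v' i) _).trans (add_le_add (add_le_add h2.le h1) ?_)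
  rw [edist_comm]
  exact h3.le

theorem continuous_of_edist_le_mul {X : Type*} [PseudoEMetricSpace X] {Φ : M → X} {C : ℝ≥0∞}
    (hC : C ≠ ∞) (h : ∀ x y, edist (Φ x) (Φ y) ≤ edist x y * C) : Continuous Φ := by
  refine LipschitzWith.continuous (K := C.toNNReal) fun x y => ?_
  rw [ENNReal.coe_toNNReal hC, mul_comm]
  exact h x y

end Convergence

section Orbits

theorem stronglyMeasurable_of_finite_pi {Ω ι M : Type*} [MeasurableSpace Ω] [Finite ι]
    [TopologicalSpace M] {f : Ω → ι → M} (hf : ∀ i, StronglyMeasurable fun ω => f ω i) :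
    StronglyMeasurable f := by
  refine ⟨fun n => ⟨fun ω i => (hf i).approx n ω, fun y => ?_, ?_⟩, fun ω => ?_⟩
  · have : (fun ω i => (hf i).approx n ω) ⁻¹' {y} = ⋂ i, (hf i).approx n ⁻¹' {y i} := by
      ext ω; simp [funext_iff]
    rw [this]
    exact MeasurableSet.iInter fun i => ((hf i).approx n).measurableSet_fiber _
  · refine (Set.Finite.pi' fun i => ((hf i).approx n).finite_range).subset ?_
    rintro _ ⟨ω, rfl⟩ i
    exact ⟨ω, rfl⟩
  · exact tendsto_pi_nhds.2 fun i => (hf i).tendsto_approx ω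

variable {Ω M : Type*} [MetricSpace M]

/-- The distance `limsup_n [n⁻¹ ∑_{k<n} d(f(T^k ω), g(T^k ω))^p]^{1/p}` between the orbits of `f`
and `g` along `ω`. It bounds the distance of their limiting barycenters. -/
def orbitDist (p : ℝ) (T : Ω → Ω) (f g : Ω → M) (ω : Ω) : ℝ≥0∞ :=
  upperAverage T (fun ω => edist (f ω) (g ω) ^ p) ω ^ (1 / p)

theorem orbitDist_comp_le {p : ℝ} (hp : 0 ≤ p) (T : Ω → Ω) (f g : Ω → M) (ω : Ω) :
    orbitDist p T f g (T ω) ≤ orbitDist p T f g ω :=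
  ENNReal.rpow_le_rpow (upperAverage_comp_le T _ ω) (by positivity)

theorem orbitDist_rpow {p : ℝ} (hp : 0 < p) (T : Ω → Ω) (f g : Ω → M) (ω : Ω) :
    orbitDist p T f g ω ^ p = upperAverage T (fun ω => edist (f ω) (g ω) ^ p) ω := by
  rw [orbitDist, one_div, ENNReal.rpow_inv_rpow hp.ne']

variable [MeasurableSpace Ω] {P : Measure Ω} {T : Ω → Ω} {p : ℝ}

theorem measurable_orbitDist (hT : Measurable T) (f g : LpMap M p P) :
    Measurable (orbitDist p T f g) :=
  (measurable_upperAverage hT ((f.measurable_edist g).pow_const p)).pow_const _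

variable [hp : Fact (1 ≤ p)]

theorem lintegral_orbitDist_rpow_le (hT : MeasurePreserving T P P) (f g : LpMap M p P) :
    ∫⁻ ω, orbitDist p T f g ω ^ p ∂P ≤ edist f g ^ p := by
  simp only [orbitDist_rpow (zero_lt_one.trans_le hp.out), LpMap.edist_rpow]
  exact lintegral_upperAverage_le hT ((f.measurable_edist g).pow_const p)

theorem ae_exists_orbitDist_lt (hT : MeasurePreserving T P P) {f : LpMap M p P}
    {S : ℕ → LpMap M p P} (hS : Tendsto S atTop (𝓝 f)) :
    ∀ᵐ ω ∂P, ∀ ε > 0, ∃ m, orbitDist p T f (S m) ω < ε := by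
  have hp0 : 0 < p := zero_lt_one.trans_le hp.out
  have hlim : Tendsto (fun m => edist f (S m) ^ p) atTop (𝓝 0) := by
    simpa [hp0] using ((tendsto_const_nhds (x := f)).edist hS).ennrpow_const p
  have hzero : ∫⁻ ω, ⨅ m, orbitDist p T f (S m) ω ^ p ∂P = 0 :=
    nonpos_iff_eq_zero.1 (ge_of_tendsto' hlim fun m => (lintegral_mono fun ω =>
      iInf_le (fun m => orbitDist p T f (S m) ω ^ p) m).trans (lintegral_orbitDist_rpow_le hT f _))
  rw [lintegral_eq_zero_iff (.iInf fun m =>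
    (measurable_orbitDist hT.measurable f (S m)).pow_const p)] at hzero
  filter_upwards [hzero] with ω hω ε hε
  obtain ⟨m, hm⟩ := iInf_lt_iff.1 (hω.trans_lt (ENNReal.rpow_pos_of_nonneg hε hp0.le))
  exact ⟨m, (ENNReal.rpow_lt_rpow_iff hp0).1 hm⟩

theorem exists_finitelyValued_ae_orbitDist_lt [MeasurableSpace M] [BorelSpace M]
    (hT : MeasurePreserving T P P) (f : LpMap M p P) :
    ∃ S : ℕ → LpMap M p P, (∀ m, S m ∈ LpMap.finitelyValued) ∧
      ∀ᵐ ω ∂P, ∀ ε > 0, ∃ m, orbitDist p T f (S m) ω < ε := by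
  obtain ⟨S, hS, hSf⟩ := mem_closure_iff_seq_limit.1 (LpMap.dense_finitelyValued f)
  exact ⟨S, hS, ae_exists_orbitDist_lt hT hSf⟩

variable [MeasurableSpace M] [BorelSpace M]

theorem stronglyMeasurable_empirical (hT : Measurable T) (β : BaryMap M p) (f : LpMap M p P)
    (n : ℕ) : StronglyMeasurable fun ω => β (empirical T f n ω) :=
  (continuous_tupleP β n).comp_stronglyMeasurable
    (stronglyMeasurable_of_finite_pi fun k => f.stronglyMeasurable.comp_measurable (hT.iterate k))

theorem edist_empirical_le (β : BaryMap M p) (f g : LpMap M p P) (n : ℕ) (ω : Ω) :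
    edist (β (empirical T f n ω)) (β (empirical T g n ω)) ≤
      birkhoffAverage ℝ≥0 T (fun ω => edist (f ω) (g ω) ^ p) (n + 1) ω ^ (1 / p) := by
  refine (edist_tupleP_le β _ _).trans_eq ?_
  rw [birkhoffAverage_eq_div, ENNReal.div_eq_inv_mul, birkhoffSum,
    Fin.sum_univ_eq_sum_range (fun k => edist (f (T^[k] ω)) (g (T^[k] ω)) ^ p) (n + 1)]

theorem eventually_edist_empirical_lt {f g : LpMap M p P} {ω : Ω} {ε : ℝ≥0∞}
    (h : orbitDist p T f g ω < ε) :
    ∀ᶠ n in atTop, ∀ β : BaryMap M p,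
      edist (β (empirical T f n ω)) (β (empirical T g n ω)) < ε := by
  have hp0 : 0 < p := zero_lt_one.trans_le hp.out
  rw [← ENNReal.rpow_lt_rpow_iff hp0, orbitDist_rpow hp0] at h
  filter_upwards [(tendsto_add_atTop_nat 1).eventually (eventually_lt_of_limsup_lt h)] with n hn β
  refine (edist_empirical_le β f g n ω).trans_lt ?_
  rwa [one_div, ENNReal.rpow_inv_lt_iff hp0]

theorem edist_le_orbitDist_of_tendsto {β : BaryMap M p} {f g : LpMap M p P} {ω : Ω} {x y : M}
    (hx : Tendsto (fun n => β (empirical T f n ω)) atTop (𝓝 x))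
    (hy : Tendsto (fun n => β (empirical T g n ω)) atTop (𝓝 y)) :
    edist x y ≤ orbitDist p T f g ω :=
  le_of_forall_gt_imp_ge_of_dense fun _ hε => le_of_tendsto (hx.edist hy)
    ((eventually_edist_empirical_lt hε).mono fun _ h => (h β).le)

end Orbits

section FinitelyValued

variable {Ω M : Type*} [MeasurableSpace Ω] [MetricSpace M] [MeasurableSpace M] [BorelSpace M]
  {P : Measure Ω} {T : Ω → Ω} {p : ℝ} [hp : Fact (1 ≤ p)]

theorem empirical_singleton (f : LpMap M p P) (n : ℕ) (ω : Ω) (a : M) :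
    (empirical T f n ω).1 {a} = birkhoffAverage ℝ≥0 T ((f ⁻¹' {a}).indicator 1) (n + 1) ω := by
  refine (tupleMeasure_apply _ (measurableSet_singleton a)).trans ?_
  rw [birkhoffAverage_eq_div, birkhoffSum,
    ← Fin.sum_univ_eq_sum_range (fun k => (f ⁻¹' {a}).indicator 1 (T^[k] ω)) (n + 1)]
  rfl

theorem ae_forall_empirical_mem (hT : MeasurePreserving T P P) {f : LpMap M p P} {F : Finset M}
    (hF : ∀ᵐ ω ∂P, f ω ∈ F) :
    ∀ᵐ ω ∂P, ∀ n, ∀ᵐ a ∂(empirical T f n ω).1, a ∈ F := by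
  filter_upwards [ae_all_iff.2 fun k => (hT.iterate k).quasiMeasurePreserving.ae hF] with ω hω n
  exact ae_mem_tupleMeasure F.measurableSet fun k => hω k

variable [IsProbabilityMeasure P]

theorem ae_tendsto_empirical_singleton (hT : MeasurePreserving T P P) (f : LpMap M p P) (a : M) :
    ∀ᵐ ω ∂P, Tendsto (fun n => (empirical T f n ω).1 {a}) atTop
      (𝓝 (upperAverage T ((f ⁻¹' {a}).indicator 1) ω)) := by
  have hfa : MeasurableSet (f ⁻¹' {a}) :=
    f.stronglyMeasurable.measurable (measurableSet_singleton a)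
  filter_upwards [ae_tendsto_birkhoffAverage_indicator hT hfa] with ω hω
  simp only [empirical_singleton]
  exact hω.comp (tendsto_add_atTop_nat 1)

theorem ae_tendsto_empirical_comp_singleton (hT : MeasurePreserving T P P) (f : LpMap M p P)
    (a : M) :
    ∀ᵐ ω ∂P, Tendsto (fun n => (empirical T f n (T ω)).1 {a}) atTop
      (𝓝 (upperAverage T ((f ⁻¹' {a}).indicator 1) ω)) := by
  have hfa : MeasurableSet (f ⁻¹' {a}) :=
    f.stronglyMeasurable.measurable (measurableSet_singleton a)
  filter_upwards [hT.quasiMeasurePreserving.ae (ae_tendsto_empirical_singleton hT f a),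
    ae_upperAverage_comp_eq hT (measurable_one.indicator hfa)
      (by simp [lintegral_indicator_one hfa])] with ω h1 h2
  rwa [h2] at h1

theorem ae_tendsto_wasserstein_empirical (hT : MeasurePreserving T P P) {f : LpMap M p P}
    (hf : f ∈ LpMap.finitelyValued) :
    ∀ᵐ ω ∂P, Tendsto
      (fun k : ℕ × ℕ => wasserstein p (empirical T f k.1 ω).1 (empirical T f k.2 ω).1)
      atTop (𝓝 0) := by
  obtain ⟨F, hF⟩ := hf
  filter_upwards [ae_forall_empirical_mem hT hF, (Finset.eventually_all F).2 fun a _ =>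
    ae_tendsto_empirical_singleton hT f a] with ω hmem hlim
  rw [← prod_atTop_atTop_eq]
  exact tendsto_wasserstein_of_tendsto_singleton (zero_lt_one.trans_le hp.out)
    (fun k => hmem k.1) (fun k => hmem k.2) (fun a ha => (hlim a ha).comp tendsto_fst)
    fun a ha => (hlim a ha).comp tendsto_snd

theorem ae_tendsto_wasserstein_empirical_comp (hT : MeasurePreserving T P P) {f : LpMap M p P}
    (hf : f ∈ LpMap.finitelyValued) :
    ∀ᵐ ω ∂P, Tendsto
      (fun n => wasserstein p (empirical T f n (T ω)).1 (empirical T f n ω).1) atTop (𝓝 0) := by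
  obtain ⟨F, hF⟩ := hf
  have hmem := ae_forall_empirical_mem hT hF
  filter_upwards [hmem, hT.quasiMeasurePreserving.ae hmem,
    (Finset.eventually_all F).2 fun a _ => ae_tendsto_empirical_singleton hT f a,
    (Finset.eventually_all F).2 fun a _ => ae_tendsto_empirical_comp_singleton hT f a]
    with ω hmem hmemT hlim hlimT
  exact tendsto_wasserstein_of_tendsto_singleton (zero_lt_one.trans_le hp.out) hmemT hmem
    hlimT hlim

theorem BaryMap.tendsto_edist_of_tendsto_wasserstein (β : BaryMap M p) {ι : Type*} {l : Filter ι}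
    {μ ν : ι → PMeas M p}
    (h : Tendsto (fun i => wasserstein p (μ i).1 (ν i).1) l (𝓝 0)) :
    Tendsto (fun i => edist (β (μ i)) (β (ν i))) l (𝓝 0) :=
  tendsto_of_tendsto_of_tendsto_of_le_of_le tendsto_const_nhds h (fun _ => zero_le)
    fun _ => β.contractive _ _

end FinitelyValued

section ErgodicLimit

variable {Ω M : Type*} [MeasurableSpace Ω] [MetricSpace M] [MeasurableSpace M] [BorelSpace M]
  {P : Measure Ω} [IsProbabilityMeasure P] {T : Ω → Ω} {p : ℝ} [hp : Fact (1 ≤ p)]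

theorem ae_cauchySeq_empirical (hT : MeasurePreserving T P P) (β : BaryMap M p)
    (f : LpMap M p P) : ∀ᵐ ω ∂P, CauchySeq fun n => β (empirical T f n ω) := by
  obtain ⟨S, hS, happrox⟩ := exists_finitelyValued_ae_orbitDist_lt hT f
  filter_upwards [happrox, ae_all_iff.2 fun m => ae_tendsto_wasserstein_empirical hT (hS m)]
    with ω hω hlim
  refine cauchySeq_of_tendsto_edist (tendsto_edist_zero_of_approx fun ε hε => ?_)
  obtain ⟨m, hm⟩ := hω ε hε
  have hclose := (eventually_edist_empirical_lt hm).mono fun _ h => h β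
  refine ⟨_, _, β.tendsto_edist_of_tendsto_wasserstein (hlim m), ?_, ?_⟩ <;>
    rw [← prod_atTop_atTop_eq]
  exacts [tendsto_fst.eventually hclose, tendsto_snd.eventually hclose]

theorem ae_tendsto_edist_empirical_comp (hT : MeasurePreserving T P P) (β : BaryMap M p)
    (f : LpMap M p P) :
    ∀ᵐ ω ∂P, Tendsto (fun n => edist (β (empirical T f n (T ω))) (β (empirical T f n ω)))
      atTop (𝓝 0) := by
  obtain ⟨S, hS, happrox⟩ := exists_finitelyValued_ae_orbitDist_lt hT f
  filter_upwards [happrox, ae_all_iff.2 fun m => ae_tendsto_wasserstein_empirical_comp hT (hS m)]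
    with ω hω hlim
  refine tendsto_edist_zero_of_approx fun ε hε => ?_
  obtain ⟨m, hm⟩ := hω ε hε
  have hmT := (orbitDist_comp_le (zero_le_one.trans hp.out) T f (S m) ω).trans_lt hm
  exact ⟨_, _, β.tendsto_edist_of_tendsto_wasserstein (hlim m),
    (eventually_edist_empirical_lt hmT).mono fun _ h => h β,
    (eventually_edist_empirical_lt hm).mono fun _ h => h β⟩

theorem exists_isErgodicLimit [CompleteSpace M] (hT : MeasurePreserving T P P) (β : BaryMap M p)
    (f : LpMap M p P) : ∃ g : LpMap M p P, IsErgodicLimit T β f g := by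
  obtain ⟨g, hg, hlim⟩ := exists_stronglyMeasurable_limit_of_tendsto_ae
    (fun n => (stronglyMeasurable_empirical hT.measurable β f n).aestronglyMeasurable (μ := P))
    ((ae_cauchySeq_empirical hT β f).mono fun ω h => cauchySeq_tendsto_of_complete h)
  have ⟨x, _⟩ := f.2
  have hconst (n : ℕ) (ω : Ω) : β (empirical T (LpMap.const p P x) n ω) = x := by
    simp only [empirical, LpMap.const_apply, tupleP_const, β.map_dirac]
  have hmoment : ∫⁻ ω, edist x (g ω) ^ p ∂P < ∞ := by
    calc ∫⁻ ω, edist x (g ω) ^ p ∂P ≤ ∫⁻ ω, orbitDist p T (LpMap.const p P x) f ω ^ p ∂P := by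
          refine lintegral_mono_ae (hlim.mono fun ω hω => ENNReal.rpow_le_rpow ?_
            (zero_le_one.trans hp.out))
          exact edist_le_orbitDist_of_tendsto (by simp [hconst]) hω
      _ ≤ edist (LpMap.const p P x) f ^ p := lintegral_orbitDist_rpow_le hT _ f
      _ < ∞ := ENNReal.rpow_lt_top_of_nonneg (zero_le_one.trans hp.out) (edist_ne_top _ _)
  refine ⟨LpMap.ofFun g hg.aestronglyMeasurable x hmoment, ?_⟩
  filter_upwards [hlim, LpMap.coeFn_ofFun hg.aestronglyMeasurable hmoment] with ω hω hgω
  rwa [hgω]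

variable [CompleteSpace M]

theorem isErgodicLimit_Gam (hT : MeasurePreserving T P P) (β : BaryMap M p) (f : LpMap M p P) :
    IsErgodicLimit T β f (Gam T β f) := by
  have h := exists_isErgodicLimit hT β f
  rw [Gam, dif_pos h]
  exact h.choose_spec

theorem ae_Gam_comp_eq (hT : MeasurePreserving T P P) (β : BaryMap M p) (f : LpMap M p P) :
    ∀ᵐ ω ∂P, Gam T β f (T ω) = Gam T β f ω := by
  have hlim := isErgodicLimit_Gam hT β f
  filter_upwards [hlim, hT.quasiMeasurePreserving.ae hlim,
    ae_tendsto_edist_empirical_comp hT β f] with ω hω hTω hdist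
  exact edist_eq_zero.1 (tendsto_nhds_unique (hTω.edist hω) hdist)

theorem ae_edist_Gam_le_orbitDist (hT : MeasurePreserving T P P) (β : BaryMap M p)
    (f g : LpMap M p P) :
    ∀ᵐ ω ∂P, edist (Gam T β f ω) (Gam T β g ω) ≤ orbitDist p T f g ω := by
  filter_upwards [isErgodicLimit_Gam hT β f, isErgodicLimit_Gam hT β g] with ω hf hg
  exact edist_le_orbitDist_of_tendsto hf hg

theorem ae_edist_Gam_le_mul_ediam (hT : MeasurePreserving T P P) (β β' : BaryMap M p)
    {f : LpMap M p P} {F : Finset M} (hF : ∀ᵐ ω ∂P, f ω ∈ F) :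
    ∀ᵐ ω ∂P, edist (Gam T β f ω) (Gam T β' f ω) ≤ edist β β' * Metric.ediam (F : Set M) := by
  filter_upwards [isErgodicLimit_Gam hT β f, isErgodicLimit_Gam hT β' f,
    ae_forall_empirical_mem hT hF] with ω h h' hmem
  exact le_of_tendsto' (h.edist h') fun n => edist_apply_le_mul_ediam β β' _ (hmem n)

theorem ae_tendsto_Gam (hT : MeasurePreserving T P P) {β : ℕ → BaryMap M p} {β' : BaryMap M p}
    (hβ : Tendsto β atTop (𝓝 β')) (f : LpMap M p P) :
    ∀ᵐ ω ∂P, Tendsto (fun k => Gam T (β k) f ω) atTop (𝓝 (Gam T β' f ω)) := by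
  obtain ⟨S, hS, happrox⟩ := exists_finitelyValued_ae_orbitDist_lt hT f
  choose F hF using hS
  filter_upwards [happrox, ae_all_iff.2 fun m => ae_edist_Gam_le_orbitDist hT β' f (S m),
    ae_all_iff.2 fun k => ae_all_iff.2 fun m => ae_edist_Gam_le_orbitDist hT (β k) f (S m),
    ae_all_iff.2 fun k => ae_all_iff.2 fun m => ae_edist_Gam_le_mul_ediam hT (β k) β' (hF m)]
    with ω hω horbit' horbit hdiam
  refine tendsto_iff_edist_tendsto_0.2 (tendsto_edist_zero_of_approx fun ε hε => ?_)
  obtain ⟨m, hm⟩ := hω ε hε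
  refine ⟨fun k => Gam T (β k) (S m) ω, fun _ => Gam T β' (S m) ω, ?_,
    .of_forall fun k => (horbit k m).trans_lt hm, .of_forall fun _ => (horbit' m).trans_lt hm⟩
  have hbound : Tendsto (fun k => edist (β k) β' * Metric.ediam (F m : Set M)) atTop (𝓝 0) := by
    simpa using ENNReal.Tendsto.mul_const (tendsto_iff_edist_tendsto_0.1 hβ)
      (.inr (F m).finite_toSet.isBounded.ediam_ne_top)
  exact tendsto_of_tendsto_of_tendsto_of_le_of_le tendsto_const_nhds hbound (fun _ => zero_le)
    fun k => hdiam k m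

theorem lipschitzWith_Gam (hT : MeasurePreserving T P P) (β : BaryMap M p) :
    LipschitzWith 1 fun f : LpMap M p P => Gam T β f := fun f g => by
  have hp0 : 0 < p := zero_lt_one.trans_le hp.out
  rw [ENNReal.coe_one, one_mul, ← ENNReal.rpow_le_rpow_iff hp0, LpMap.edist_rpow]
  calc ∫⁻ ω, edist (Gam T β f ω) (Gam T β g ω) ^ p ∂P ≤ ∫⁻ ω, orbitDist p T f g ω ^ p ∂P :=
        lintegral_mono_ae ((ae_edist_Gam_le_orbitDist hT β f g).mono fun _ h =>
          ENNReal.rpow_le_rpow h hp0.le)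
    _ ≤ edist f g ^ p := lintegral_orbitDist_rpow_le hT f g

theorem continuous_Gam (hT : MeasurePreserving T P P) :
    Continuous fun q : BaryMap M p × LpMap M p P => Gam T q.1 q.2 := by
  refine continuous_prod_of_dense_continuous_lipschitzWith' _ 1 LpMap.dense_finitelyValued
    (lipschitzWith_Gam hT) ?_
  rintro f ⟨F, hF⟩
  exact continuous_of_edist_le_mul F.finite_toSet.isBounded.ediam_ne_top fun β β' =>
    LpMap.edist_le_of_ae_le (ae_edist_Gam_le_mul_ediam hT β β' hF)

end ErgodicLimit

section Expectation

variable {Ω M : Type*} [MeasurableSpace Ω] [MetricSpace M] [MeasurableSpace M] [BorelSpace M]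
  {P : Measure Ω} [IsProbabilityMeasure P] {p : ℝ} [hp : Fact (1 ≤ p)]

theorem lipschitzWith_expect (β : BaryMap M p) :
    LipschitzWith 1 fun f : LpMap M p P => expect β f := fun f g => by
  rw [ENNReal.coe_one, one_mul]
  exact (β.contractive _ _).trans (wasserstein_map_le (zero_le_one.trans hp.out) P
    f.stronglyMeasurable.measurable g.stronglyMeasurable.measurable)

theorem continuous_expect :
    Continuous fun q : BaryMap M p × LpMap M p P => expect q.1 q.2 := by
  refine continuous_prod_of_dense_continuous_lipschitzWith' _ 1 LpMap.dense_finitelyValued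
    lipschitzWith_expect ?_
  rintro f ⟨F, hF⟩
  refine continuous_of_edist_le_mul F.finite_toSet.isBounded.ediam_ne_top fun β β' =>
    edist_apply_le_mul_ediam β β' f.law ?_
  exact (ae_map_iff f.stronglyMeasurable.measurable.aemeasurable F.measurableSet).2 hF

end Expectation

end

end BaryErgodic

theorem theorem5p2_general {Ω M : Type*} [MeasurableSpace Ω] (P : Measure Ω)
    [IsProbabilityMeasure P] [MetricSpace M] [CompleteSpace M] [MeasurableSpace M] [BorelSpace M]
    (p : ℝ) [Fact (1 ≤ p)] (T : Ω → Ω) (hT : MeasurePreserving T P P) :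
    (∀ (β : BaryErgodic.BaryMap M p) (φ : BaryErgodic.LpMap M p P),
      BaryErgodic.IsErgodicLimit T β φ (BaryErgodic.Gam T β φ) ∧
      ∀ᵐ ω ∂P, BaryErgodic.Gam T β φ (T ω) = BaryErgodic.Gam T β φ ω) ∧
    Continuous (fun q : BaryErgodic.BaryMap M p × BaryErgodic.LpMap M p P =>
      BaryErgodic.Gam T q.1 q.2) ∧
    Continuous (fun q : BaryErgodic.BaryMap M p × BaryErgodic.LpMap M p P =>
      BaryErgodic.expect q.1 q.2) ∧
    ∀ (β : ℕ → BaryErgodic.BaryMap M p) (β' : BaryErgodic.BaryMap M p),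
      Tendsto β atTop (𝓝 β') →
      ∀ φ : BaryErgodic.LpMap M p P,
        ∀ᵐ ω ∂P, Tendsto (fun k => BaryErgodic.Gam T (β k) φ ω) atTop
          (𝓝 (BaryErgodic.Gam T β' φ ω)) :=
  ⟨fun β φ => ⟨BaryErgodic.isErgodicLimit_Gam hT β φ, BaryErgodic.ae_Gam_comp_eq hT β φ⟩,
    BaryErgodic.continuous_Gam hT, BaryErgodic.continuous_expect,
    fun _ _ hβ φ => BaryErgodic.ae_tendsto_Gam hT hβ φ⟩

theorem theorem5p2 {Ω M : Type*} [MeasurableSpace Ω] (P : Measure Ω) [IsProbabilityMeasure P]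
    [MetricSpace M] [CompleteSpace M] [MeasurableSpace M] [BorelSpace M]
    (p : ℝ) [Fact (1 ≤ p)] (T : Ω → Ω) (hT : MeasurePreserving T P P) :
    (∀ (β : BaryErgodic.BaryMap M p) (φ : BaryErgodic.LpMap M p P),
      BaryErgodic.IsErgodicLimit T β φ (BaryErgodic.Gam T β φ) ∧
      ∀ᵐ ω ∂P, BaryErgodic.Gam T β φ (T ω) = BaryErgodic.Gam T β φ ω) ∧
    Continuous (fun q : BaryErgodic.BaryMap M p × BaryErgodic.LpMap M p P =>
      BaryErgodic.Gam T q.1 q.2) ∧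
    (Ergodic T P →
      ∀ (β : ℕ → BaryErgodic.BaryMap M p) (β' : BaryErgodic.BaryMap M p)
        (φ : ℕ → BaryErgodic.LpMap M p P) (φ' : BaryErgodic.LpMap M p P),
        Tendsto β atTop (𝓝 β') → Tendsto φ atTop (𝓝 φ') →
        Tendsto (fun k => BaryErgodic.expect (β k) (φ k)) atTop
          (𝓝 (BaryErgodic.expect β' φ'))) ∧
    (StandardBorelSpace Ω →
      ∀ (β : ℕ → BaryErgodic.BaryMap M p) (β' : BaryErgodic.BaryMap M p),
        Tendsto β atTop (𝓝 β') →
        ∀ φ : BaryErgodic.LpMap M p P,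
          ∀ᵐ ω ∂P, Tendsto (fun k => BaryErgodic.Gam T (β k) φ ω) atTop
            (𝓝 (BaryErgodic.Gam T β' φ ω))) := by
  obtain ⟨hlim, hGam, hexpect, hae⟩ := theorem5p2_general (M := M) P p T hT
  exact ⟨hlim, hGam, fun _ _ β' _ φ' hβ hφ =>
    (hexpect.tendsto (β', φ')).comp (hβ.prodMk_nhds hφ), fun _ => hae⟩
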